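/- Let $p\in(2,3)$, $T>0$, $d\in\mathbb N_0$ and $\hat d=1+d+\frac{d(d+1)}2$. Write $\Delta_T=\{(s,t):0\le s\le t\le T\}$ and, for a path $X$, $X_{s,t}=X_t-X_s$. For $r>0$ and a two-parameter function $A$ on $\Delta_T$ put $\|A\|_r=\big(\sup_{\mathcal P}\sum_{[u,v]\in\mathcal P}|A_{u,v}|^r\big)^{1/r}$, the supremum being over the partitions of $[0,T]$ and $|\cdot|$ the Euclidean norm; for a path, $\|X\|_r$ is the $r$-variation of its increments. A rough path over $\mathbb R^n$ is a pair $\mathbf X=(X,\mathbb X^{(2)})$ of continuous functions $X:[0,T]\to\mathbb R^n$, $\mathbb X^{(2)}:\Delta_T\to\mathbb R^{n\times n}$ with $\|X\|_p<\infty$, $\|\mathbb X^{(2)}\|_{p/2}<\infty$ and $\mathbb X^{(2)}_{s,t}=\mathbb X^{(2)}_{s,u}+\mathbb X^{(2)}_{u,t}+X_{s,u}\otimes X_{u,t}$ for $0\le s\le u\le t\le T$; it need not be weakly geometric. Let $\|\mathbf X\|_p=\|X\|_p+\|\mathbb X^{(2)}\|_{p/2}$, let $[\mathbf X]_t=X_{0,t}\otimes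 X_{0,t}-\big(\mathbb X^{(2)}_{0,t}+(\mathbb X^{(2)}_{0,t})^\top\big)$ be its bracket, and equip the space of rough paths with the topology of the pseudo-distance $\|X-Y\|_p+\|\mathbb X^{(2)}-\mathbb Y^{(2)}\|_{p/2}$. The signature of $\mathbf X$ is its Lyons extension: the unique continuous $(s,t)\mapsto\mathbb X_{s,t}\in T((\mathbb R^n))=\prod_{k\ge0}(\mathbb R^n)^{\otimes k}$ on $\Delta_T$ with levels $0,1,2$ equal to $1,X_{s,t},\mathbb X^{(2)}_{s,t}$, with $\mathbb X_{s,t}=\mathbb X_{s,u}\otimes\mathbb X_{u,t}$ for $s\le u\le t$, and with level $k$ of finite $p/k$-variation for every $k\ge1$. Write $\mathbb X_T=\mathbb X_{0,T}$. Let $\widehat{\mathcal C}^p$ be the set of the rough paths $\widehat{\mathbf X}=(\widehat X,\widehat{\mathbb X}^{(2)})$ over $\mathbb R^{\hat d}$ obtained from rough paths $(X,\mathbb X^{(2)})$ over $\mathbb R^d$ as follows: $\widehat X_t=(t,X_t,Q(X)_t)$ with $Q(X)=([\mathbf X]^{ij})_{1\le i\le j\le d}$; the component of $\widehat{\mathbb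 X}^{(2)}$ at two coordinates of $X$ is that of $\mathbb X^{(2)}$, and at every other pair $(a,b)$ of coordinates it is the Young integral $\int_s^t\widehat X^a_{s,r}\,\mathrm d\widehat X^b_r$. Let $K\subset\widehat{\mathcal C}^p$ be compact (hence bounded), $f:K\to\mathbb R$ continuous, $L>0$, and $K_L=\{\widehat{\mathbf X}\in K:\ \|\widehat{\mathbf X}\|_p+\|[\widehat{\mathbf X}]\|_{p/2}\le L\}$. Then every $\widehat{\mathbf X}\in K$ has exactly one Lyons extension $\widehat{\mathbb X}$, and for every $\epsilon>0$ there is $\ell\in T(\mathbb R^{\hat d})=\bigoplus_{k\ge0}(\mathbb R^{\hat d})^{\otimes k}$ such that $$\sup_{\widehat{\mathbf X}\in K_L}\big|f(\widehat{\mathbf X})-\langle\ell,\widehat{\mathbb X}_T\rangle\big|<\epsilon .$$ -/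

import Mathlib

open scoped ENNReal

noncomputable section

namespace RoughUAT

/-! Paths on `[0,T]` are total functions on `ℝ`, and two-parameter functions on the simplex
`0 ≤ s ≤ t ≤ T` are total functions `ℝ → ℝ → E`. All conditions and all quantities below only
involve times in `[0,T]`, respectively in the simplex, so the other values are irrelevant. -/

/-- The simplex `Δ_T`. -/
def simplex (T : ℝ) : Set (ℝ × ℝ) := {x | 0 ≤ x.1 ∧ x.1 ≤ x.2 ∧ x.2 ≤ T}

/-- `u 0 < u 1 < ⋯ < u N` is a partition of `[s,t]`. -/
def IsPartition (s t : ℝ) (N : ℕ) (u : ℕ → ℝ) : Prop :=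
  u 0 = s ∧ u N = t ∧ ∀ i < N, u i < u (i + 1)

/-- The `r`-variation of a two-parameter function over `[s,t]`, possibly infinite. -/
def rVar {E : Type*} [NormedAddCommGroup E] (r : ℝ) (A : ℝ → ℝ → E) (s t : ℝ) : ℝ≥0∞ :=
  (⨆ (N : ℕ) (u : ℕ → ℝ) (_ : IsPartition s t N u),
    ∑ i ∈ Finset.range N, ‖A (u i) (u (i + 1))‖ₑ ^ r) ^ (1 / r)

/-- The increments `X_{s,t} = X_t - X_s` of a path. -/
def incr {E : Type*} [NormedAddCommGroup E] (X : ℝ → E) (s t : ℝ) : E := X t - X s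

/-- Rough paths of finite `p`-variation over `ℝ^ι` on `[0,T]`, for `p ∈ [2,3)`; the second level
takes values in `ℝ^{ι × ι} = ℝ^ι ⊗ ℝ^ι` with the Euclidean norm. -/
structure RoughPath (p T : ℝ) (ι : Type*) [Fintype ι] where
  two_le : 2 ≤ p
  lt_three : p < 3
  path : ℝ → EuclideanSpace ℝ ι
  lift : ℝ → ℝ → EuclideanSpace ℝ (ι × ι)
  path_continuousOn : ContinuousOn path (Set.Icc 0 T)
  lift_continuousOn : ContinuousOn (fun x : ℝ × ℝ => lift x.1 x.2) (simplex T)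
  path_rVar : rVar p (incr path) 0 T < ∞
  lift_rVar : rVar (p / 2) lift 0 T < ∞
  chen : ∀ s u t : ℝ, 0 ≤ s → s ≤ u → u ≤ t → t ≤ T → ∀ i j : ι,
    lift s t (i, j) = lift s u (i, j) + lift u t (i, j) + incr path s u i * incr path u t j

theorem rVar_zero {E : Type*} [NormedAddCommGroup E] {r : ℝ} (hr : 0 < r) (s t : ℝ) :
    rVar r (fun _ _ => (0 : E)) s t = 0 := by
  simp [rVar, hr]

theorem rVar_congr {E : Type*} [NormedAddCommGroup E] {r : ℝ} {A B : ℝ → ℝ → E}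
    (h : ∀ u v, ‖A u v‖ₑ = ‖B u v‖ₑ) (s t : ℝ) : rVar r A s t = rVar r B s t := by
  simp only [rVar, h]

theorem rVar_add_le {E : Type*} [NormedAddCommGroup E] {r : ℝ} (hr : 1 ≤ r)
    (A B : ℝ → ℝ → E) (s t : ℝ) :
    rVar r (fun u v => A u v + B u v) s t ≤ rVar r A s t + rVar r B s t := by
  have hr0 : 0 < r := by linarith
  have key : ∀ (C : ℝ → ℝ → E) (N : ℕ) (u : ℕ → ℝ), IsPartition s t N u →
      (∑ i ∈ Finset.range N, ‖C (u i) (u (i + 1))‖ₑ ^ r) ^ (1 / r) ≤ rVar r C s t := by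
    intro C N u hu
    refine ENNReal.rpow_le_rpow ?_ (by positivity)
    exact le_iSup_of_le N (le_iSup_of_le u (le_iSup_of_le hu le_rfl))
  rw [rVar, one_div, ENNReal.rpow_inv_le_iff hr0]
  refine iSup_le fun N => iSup_le fun u => iSup_le fun hu => ?_
  rw [← ENNReal.rpow_inv_le_iff hr0, ← one_div]
  calc (∑ i ∈ Finset.range N, ‖A (u i) (u (i + 1)) + B (u i) (u (i + 1))‖ₑ ^ r) ^ (1 / r)
      ≤ (∑ i ∈ Finset.range N,
          (‖A (u i) (u (i + 1))‖ₑ + ‖B (u i) (u (i + 1))‖ₑ) ^ r) ^ (1 / r) := by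
        gcongr
        exact enorm_add_le _ _
    _ ≤ _ := ENNReal.Lp_add_le _ _ _ hr
    _ ≤ _ := add_le_add (key A N u hu) (key B N u hu)

namespace RoughPath

variable {p T : ℝ} {ι : Type*} [Fintype ι]

/-- The rough path distance `‖X - Y‖_p + ‖𝕏 - 𝕐‖_{p/2}`. It is a pseudo-distance: like the rough
path seminorm, it does not see the starting points of the paths. -/
instance : PseudoEMetricSpace (RoughPath p T ι) where
  edist X Y := rVar p (fun s t => incr X.path s t - incr Y.path s t) 0 T
    + rVar (p / 2) (fun s t => X.lift s t - Y.lift s t) 0 T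
  edist_self X := by
    have := X.two_le
    simp only [sub_self]
    rw [rVar_zero (by linarith), rVar_zero (by linarith), add_zero]
  edist_comm X Y := by
    congr 1 <;> exact rVar_congr (fun u v => by rw [← enorm_neg, neg_sub]) _ _
  edist_triangle X Y Z := by
    have := X.two_le
    have h1 := rVar_add_le (r := p) (by linarith)
      (fun s t => incr X.path s t - incr Y.path s t)
      (fun s t => incr Y.path s t - incr Z.path s t) 0 T
    have h2 := rVar_add_le (r := p / 2) (by linarith)
      (fun s t => X.lift s t - Y.lift s t) (fun s t => Y.lift s t - Z.lift s t) 0 T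
    simp only [sub_add_sub_cancel] at h1 h2
    refine (add_le_add h1 h2).trans (le_of_eq ?_)
    ring

/-- The rough path seminorm `‖X‖_p + ‖𝕏‖_{p/2}` on `[0,T]`. -/
def seminorm (X : RoughPath p T ι) : ℝ≥0∞ :=
  rVar p (incr X.path) 0 T + rVar (p / 2) X.lift 0 T

/-- The rough path bracket `[X]_t = X_{0,t} ⊗ X_{0,t} - (𝕏_{0,t} + 𝕏_{0,t}ᵀ)`. -/
def bracket (X : RoughPath p T ι) (t : ℝ) : EuclideanSpace ℝ (ι × ι) :=
  WithLp.toLp 2 fun ij => incr X.path 0 t ij.1 * incr X.path 0 t ij.2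
    - (X.lift 0 t ij + X.lift 0 t ij.swap)

end RoughPath

/-! ### The extended tensor algebra and Lyons' extension -/

/-- Elements `𝐚 = ∑_I a_I e_I` of `T((ℝ^ι))`, given by their coordinates on words. -/
abbrev TensorSeries (ι : Type*) := List ι → ℝ

/-- The component in `(ℝ^ι)^{⊗ n}`, with the Euclidean norm. -/
def TensorSeries.level {ι : Type*} (n : ℕ) (a : TensorSeries ι) :
    EuclideanSpace ℝ (Fin n → ι) :=
  WithLp.toLp 2 fun w => a (List.ofFn w)

/-- The tensor multiplication `⊗` of `T((ℝ^ι))`: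
the coordinate on a word is the sum over all ways to cut the word in two. -/
def TensorSeries.tmul {ι : Type*} (a b : TensorSeries ι) : TensorSeries ι :=
  fun I => ∑ k ∈ Finset.range (I.length + 1), a (I.take k) * b (I.drop k)

/-- The pairing `⟨ℓ, 𝐚⟩ = ∑_I ℓ_I a_I` of `ℓ ∈ T(ℝ^ι)` (finitely many non-zero coordinates) with
`𝐚 ∈ T((ℝ^ι))`. -/
def pairing {ι : Type*} (ℓ : List ι →₀ ℝ) (a : TensorSeries ι) : ℝ :=
  ℓ.sum fun I c => c * a I

/-- `S` is a Lyons extension of the rough path `X`: a continuous multiplicative functional with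
values in `T((ℝ^ι))`, of finite `p`-variation (that is, with level `n` of finite `p/n`-variation),
which extends `(1, X, 𝕏)`. -/
structure IsLyonsExtension {p T : ℝ} {ι : Type*} [Fintype ι] (X : RoughPath p T ι)
    (S : ℝ → ℝ → TensorSeries ι) : Prop where
  level_zero : ∀ s t : ℝ, (s, t) ∈ simplex T → S s t [] = 1
  level_one : ∀ s t : ℝ, (s, t) ∈ simplex T → ∀ i, S s t [i] = incr X.path s t i
  level_two : ∀ s t : ℝ, (s, t) ∈ simplex T → ∀ i j, S s t [i, j] = X.lift s t (i, j)
  chen : ∀ s u t : ℝ, 0 ≤ s → s ≤ u → u ≤ t → t ≤ T →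
    S s t = TensorSeries.tmul (S s u) (S u t)
  continuousOn : ∀ n : ℕ,
    ContinuousOn (fun x : ℝ × ℝ => TensorSeries.level n (S x.1 x.2)) (simplex T)
  rVar_lt : ∀ n : ℕ, 1 ≤ n → rVar (p / n) (fun s t => TensorSeries.level n (S s t)) 0 T < ∞

open Classical in
/-- The signature `(s,t) ↦ 𝕏_{s,t}` of a rough path: its Lyons extension. -/
def signature {p T : ℝ} {ι : Type*} [Fintype ι] (X : RoughPath p T ι) :
    ℝ → ℝ → TensorSeries ι :=
  if h : ∃ S, IsLyonsExtension X S then h.choose else 0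

/-! ### Extension by time and by the bracket terms -/

/-- Indices of the extended path `(t, X, Q(X))`: time, the `d` components of `X`, and the pairs
`i ≤ j` for the components of the bracket. -/
abbrev ExtIndex (d : ℕ) := Unit ⊕ Fin d ⊕ {ij : Fin d × Fin d // ij.1 ≤ ij.2}

/-- The index of the component `i` of `X` in the extended path. -/
abbrev ExtIndex.ofPath {d : ℕ} (i : Fin d) : ExtIndex d := Sum.inr (Sum.inl i)

/-- The extended path `(t, X_t, Q(X)_t)`. -/
def extPath {p T : ℝ} {d : ℕ} (X : RoughPath p T (Fin d)) (t : ℝ) :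
    EuclideanSpace ℝ (ExtIndex d) :=
  WithLp.toLp 2 (Sum.elim (fun _ => t) (Sum.elim (fun i => X.path t i)
    (fun ij => X.bracket t ij.1)))

/-- `J = ∫_s^t F dG` as a Young integral: the limit of the Riemann sums
`∑ F_u (G_v - G_u)` along the partitions of `[s,t]` as the mesh tends to zero. -/
def IsYoungIntegral (F G : ℝ → ℝ) (s t J : ℝ) : Prop :=
  ∀ ε > 0, ∃ δ > 0, ∀ (N : ℕ) (u : ℕ → ℝ), IsPartition s t N u →
    (∀ i < N, u (i + 1) - u i < δ) →
    |∑ i ∈ Finset.range N, F (u i) * (G (u (i + 1)) - G (u i)) - J| < ε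

/-- The space of rough paths extended by time and by the rough path bracket: the canonical lifts
of `(t, X, Q(X))` for rough paths `(X, 𝕏)` over `ℝ^d`. The second level of the canonical lift is
`𝕏` on the components of `X`, and a Young integral on all other pairs of components. -/
def extendedRoughPaths (p T : ℝ) (d : ℕ) : Set (RoughPath p T (ExtIndex d)) :=
  {Y | ∃ X : RoughPath p T (Fin d),
    (∀ t ∈ Set.Icc 0 T, Y.path t = extPath X t) ∧
    (∀ s t : ℝ, (s, t) ∈ simplex T → ∀ i j : Fin d,
      Y.lift s t (ExtIndex.ofPath i, ExtIndex.ofPath j) = X.lift s t (i, j)) ∧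
    (∀ s t : ℝ, (s, t) ∈ simplex T → ∀ a b : ExtIndex d,
      ¬ (a ∈ Set.range ExtIndex.ofPath ∧ b ∈ Set.range ExtIndex.ofPath) →
      IsYoungIntegral (fun r => incr Y.path s r a) (fun r => Y.path r b) s t
        (Y.lift s t (a, b)))}

/-- The part of `K` on which `‖(X, 𝕏)‖_p + ‖[X]‖_{p/2} ≤ L`. -/
def boundedPart {p T : ℝ} {ι : Type*} [Fintype ι] (K : Set (RoughPath p T ι)) (L : ℝ) :
    Set (RoughPath p T ι) :=
  {X ∈ K | X.seminorm + rVar (p / 2) (incr X.bracket) 0 T ≤ ENNReal.ofReal L}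

end RoughUAT

end

noncomputable section

namespace RoughUAT

/-! ### Partitions and controls -/

/-! The approximation is Stone–Weierstrass on the compact set K, with paths at distance zero
identified. It needs three facts about the coordinates of the signature at time T: they are
continuous in the rough path, their linear span is an algebra, and they separate paths at positive
distance.

Everything analytic rests on one principle (`IsControl.additive_eq_zero`): an additive function of
intervals bounded by a power greater than one of a control is zero. Its quantitative companion is
the maximal inequality of the sewing lemma (`IsControl.abs_sub_sum_le`). By Chen's relation, the
defect of additivity of a coordinate involves shorter words only, so inductions on the length of
words apply. Sewing yields Lyons' extension, additivity yields its uniqueness, and the bounds are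
uniform in the path. Hence near a given rough path a coordinate is uniformly close to a finite sum
of products of coordinates on shorter words, and it is continuous (`continuous_signature`).

Algebra: without weak geometricity the shuffle identity fails, since X^i X^j = 𝕏^{ij} + 𝕏^{ji} +
[X]^{ij}. The bracket is itself a coordinate of the extended path, however, so products of
coordinates are quasi-shuffles, two path letters merging into a bracket letter (`signature_mul`).
Path letters get weight 1, time and bracket letters weight 2. A coordinate on a word of weight m is
of order ω^{m/p}, so an identity homogeneous in weight has to be checked only up to weight 2,
because 3/p > 1. For pairs containing a letter of weight 2 this order comes from the Young
integrals.

Separation: appending the time letter integrates a coordinate in time (`signature_append_time`). If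
two signatures agree at T, all iterated time integrals of the difference of any coordinate vanish at
T. Thus all its moments vanish and, by Weierstrass, the difference is zero on [0,T]. Levels one and
two on [0,t] then agree for all t, and Chen's relation gives them on every [s,t]. -/

theorem IsPartition.le {s t : ℝ} {N : ℕ} {u : ℕ → ℝ} (h : IsPartition s t N u) {i j : ℕ}
    (hij : i ≤ j) (hj : j ≤ N) : u i ≤ u j := by
  induction j, hij using Nat.le_induction with
  | base => exact le_rfl
  | succ j _ ih => exact (ih (by omega)).trans (h.2.2 j (by omega)).le

theorem IsPartition.left_le {s t : ℝ} {N : ℕ} {u : ℕ → ℝ} (h : IsPartition s t N u) {i : ℕ}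
    (hi : i ≤ N) : s ≤ u i := h.1 ▸ h.le (Nat.zero_le i) hi

theorem IsPartition.le_right {s t : ℝ} {N : ℕ} {u : ℕ → ℝ} (h : IsPartition s t N u) {i : ℕ}
    (hi : i ≤ N) : u i ≤ t := h.2.1 ▸ h.le hi le_rfl

theorem isPartition_refl (s : ℝ) : IsPartition s s 0 fun _ => s :=
  ⟨rfl, rfl, fun _ hi => absurd hi (Nat.not_lt_zero _)⟩

theorem isPartition_pair {s t : ℝ} (h : s < t) :
    IsPartition s t 1 fun i => if i = 0 then s else t :=
  ⟨by simp, by simp, fun i hi => by obtain rfl : i = 0 := by omega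
                                    simpa using h⟩

/-- The concatenation of two sequences of times. -/
def concat (N : ℕ) (u v : ℕ → ℝ) (i : ℕ) : ℝ := if i ≤ N then u i else v (i - N)

theorem concat_left {N : ℕ} {u v : ℕ → ℝ} {i : ℕ} (hi : i ≤ N) : concat N u v i = u i :=
  if_pos hi

theorem concat_right {N : ℕ} {u v : ℕ → ℝ} (h : u N = v 0) (i : ℕ) :
    concat N u v (N + i) = v i := by
  rcases Nat.eq_zero_or_pos i with rfl | hi
  · simp [concat, h]
  · rw [concat, if_neg (by omega)]; congr 1; omega

theorem IsPartition.concat {s t r : ℝ} {N M : ℕ} {u v : ℕ → ℝ} (hu : IsPartition s t N u)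
    (hv : IsPartition t r M v) : IsPartition s r (N + M) (concat N u v) := by
  have h : u N = v 0 := hu.2.1.trans hv.1.symm
  refine ⟨by rw [concat_left (Nat.zero_le _), hu.1], by rw [concat_right h, hv.2.1],
    fun i hi => ?_⟩
  rcases Nat.lt_or_ge i N with hiN | hiN
  · rw [concat_left hiN.le, concat_left hiN]; exact hu.2.2 i hiN
  · obtain ⟨k, rfl⟩ := Nat.exists_eq_add_of_le hiN
    rw [concat_right h, add_assoc, concat_right h]
    exact hv.2.2 k (by omega)

theorem sum_concat {E : Type*} [AddCommMonoid E] {N M : ℕ} {u v : ℕ → ℝ} (h : u N = v 0)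
    (g : ℝ → ℝ → E) :
    ∑ i ∈ Finset.range (N + M), g (concat N u v i) (concat N u v (i + 1))
      = ∑ i ∈ Finset.range N, g (u i) (u (i + 1)) + ∑ i ∈ Finset.range M, g (v i) (v (i + 1)) := by
  rw [Finset.sum_range_add]
  congr 1
  · refine Finset.sum_congr rfl fun i hi => ?_
    rw [Finset.mem_range] at hi
    rw [concat_left hi.le, concat_left hi]
  · refine Finset.sum_congr rfl fun i _ => ?_
    rw [concat_right h, add_assoc, concat_right h]

/-- Controls on `[0,T]`: non-negative superadditive functions of intervals which vanish
asymptotically on intervals shrinking to one of their end points. -/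
structure IsControl (T : ℝ) (ω : ℝ → ℝ → ℝ) : Prop where
  nonneg : ∀ s t : ℝ, 0 ≤ s → s ≤ t → t ≤ T → 0 ≤ ω s t
  superadd : ∀ s u t : ℝ, 0 ≤ s → s ≤ u → u ≤ t → t ≤ T → ω s u + ω u t ≤ ω s t
  right_small : ∀ m : ℝ, 0 ≤ m → m < T → ∀ η > 0, ∃ t, m < t ∧ t ≤ T ∧ ω m t < η
  left_small : ∀ m : ℝ, 0 < m → m ≤ T → ∀ η > 0, ∃ t, 0 ≤ t ∧ t < m ∧ ω t m < η

namespace IsControl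

variable {T : ℝ} {ω : ℝ → ℝ → ℝ}

theorem mono (hω : IsControl T ω) {s s' t' t : ℝ} (h0 : 0 ≤ s) (h1 : s ≤ s') (h2 : s' ≤ t')
    (h3 : t' ≤ t) (hT : t ≤ T) : ω s' t' ≤ ω s t := by
  have a := hω.superadd s s' t h0 h1 (h2.trans h3) hT
  have b := hω.superadd s' t' t (h0.trans h1) h2 h3 hT
  have c := hω.nonneg s s' h0 h1 (by linarith)
  have e := hω.nonneg t' t (by linarith) h3 hT
  linarith

theorem self_eq_zero (hω : IsControl T ω) {s : ℝ} (h0 : 0 ≤ s) (hT : s ≤ T) : ω s s = 0 := by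
  have a := hω.superadd s s s h0 le_rfl le_rfl hT
  have b := hω.nonneg s s h0 le_rfl hT
  linarith

theorem add {ω' : ℝ → ℝ → ℝ} (hω : IsControl T ω) (hω' : IsControl T ω') :
    IsControl T fun s t => ω s t + ω' s t where
  nonneg s t h0 h hT := add_nonneg (hω.nonneg s t h0 h hT) (hω'.nonneg s t h0 h hT)
  superadd s u t h0 h h' hT := by
    have a := hω.superadd s u t h0 h h' hT
    have b := hω'.superadd s u t h0 h h' hT
    linarith
  right_small m h0 hT η hη := by
    obtain ⟨t, h1, h2, h3⟩ := hω.right_small m h0 hT (η / 2) (by linarith)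
    obtain ⟨t', h1', h2', h3'⟩ := hω'.right_small m h0 hT (η / 2) (by linarith)
    refine ⟨min t t', lt_min h1 h1', (min_le_left _ _).trans h2, ?_⟩
    have a := hω.mono h0 le_rfl (lt_min h1 h1').le (min_le_left t t') h2
    have b := hω'.mono h0 le_rfl (lt_min h1 h1').le (min_le_right t t') h2'
    linarith
  left_small m h0 hT η hη := by
    obtain ⟨t, h1, h2, h3⟩ := hω.left_small m h0 hT (η / 2) (by linarith)
    obtain ⟨t', h1', h2', h3'⟩ := hω'.left_small m h0 hT (η / 2) (by linarith)
    refine ⟨max t t', h1.trans (le_max_left _ _), max_lt h2 h2', ?_⟩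
    have a := hω.mono h1 (le_max_left t t') (max_lt h2 h2').le le_rfl hT
    have b := hω'.mono h1' (le_max_right t t') (max_lt h2 h2').le le_rfl hT
    linarith

theorem length (T : ℝ) : IsControl T fun s t => t - s where
  nonneg s t _ h _ := sub_nonneg.2 h
  superadd s u t _ _ _ _ := by linarith
  right_small m _ hT η hη := by
    refine ⟨min (m + η / 2) T, lt_min (by linarith) hT, min_le_right _ _, ?_⟩
    have := min_le_left (m + η / 2) T
    linarith
  left_small m h0 _ η hη := by
    refine ⟨max (m - η / 2) 0, le_max_right _ _, max_lt (by linarith) h0, ?_⟩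
    have := le_max_left (m - η / 2) 0
    linarith

theorem sum_le (hω : IsControl T ω) {N : ℕ} {u : ℕ → ℝ} (h0 : 0 ≤ u 0)
    (hu : ∀ i < N, u i ≤ u (i + 1)) (hT : u N ≤ T) :
    ∑ i ∈ Finset.range N, ω (u i) (u (i + 1)) ≤ ω (u 0) (u N) := by
  have hm : ∀ n ≤ N, u 0 ≤ u n ∧ u n ≤ u N := by
    intro n hn
    constructor
    · induction n with
      | zero => exact le_rfl
      | succ n ih => exact (ih (by omega)).trans (hu n (by omega))
    · induction hn using Nat.decreasingInduction with
      | self => exact le_rfl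
      | of_succ k hk ih => exact (hu k hk).trans ih
  suffices ∀ n ≤ N, ∑ i ∈ Finset.range n, ω (u i) (u (i + 1)) ≤ ω (u 0) (u n) from this N le_rfl
  intro n hn
  induction n with
  | zero => simpa using hω.nonneg _ _ h0 le_rfl ((hm N le_rfl).1.trans hT)
  | succ n ih =>
    rw [Finset.sum_range_succ]
    have := hω.superadd (u 0) (u n) (u (n + 1)) h0 (hm n (by omega)).1 (hu n (by omega))
      ((hm _ hn).2.trans hT)
    linarith [ih (by omega)]

/-- Real induction on the set of points reachable by a fine partition: smallness to the left puts
the supremum in the set, smallness to the right pushes past it. One-sided smallness replaces joint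
continuity of the control. -/
theorem exists_fine_partition (hω : IsControl T ω) {s t : ℝ} (h0 : 0 ≤ s) (hst : s ≤ t)
    (hT : t ≤ T) {η : ℝ} (hη : 0 < η) :
    ∃ (N : ℕ) (u : ℕ → ℝ), IsPartition s t N u ∧ ∀ i < N, ω (u i) (u (i + 1)) < η := by
  let G : Set ℝ := {x | s ≤ x ∧ x ≤ t ∧
    ∃ (N : ℕ) (u : ℕ → ℝ), IsPartition s x N u ∧ ∀ i < N, ω (u i) (u (i + 1)) < η}
  have ext : ∀ x ∈ G, ∀ y, x < y → y ≤ t → ω x y < η → y ∈ G := by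
    rintro x ⟨h1, _, N, u, hu, hs⟩ y hxy hyt hy
    refine ⟨by linarith, hyt, N + 1, _, hu.concat (isPartition_pair hxy), fun i hi => ?_⟩
    rcases Nat.lt_or_ge i N with hiN | hiN
    · rw [concat_left hiN.le, concat_left hiN]; exact hs i hiN
    · obtain rfl : i = N := by omega
      rw [concat_left le_rfl, hu.2.1, concat_right (by simp [hu.2.1])]
      simpa using hy
  have hsG : s ∈ G := ⟨le_rfl, hst, 0, _, isPartition_refl s, fun _ h => absurd h (by omega)⟩
  have hbdd : BddAbove G := ⟨t, fun x hx => hx.2.1⟩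
  set x := sSup G with hx
  have hsx : s ≤ x := le_csSup hbdd hsG
  have hxt : x ≤ t := csSup_le ⟨s, hsG⟩ fun y hy => hy.2.1
  have hxG : x ∈ G := by
    rcases hsx.eq_or_lt with h | h
    · rwa [← h]
    obtain ⟨y, hy0, hyx, hy⟩ := hω.left_small x (by linarith) (by linarith) η hη
    obtain ⟨g, hg, hyg⟩ := exists_lt_of_lt_csSup ⟨s, hsG⟩ hyx
    rcases (le_csSup hbdd hg).eq_or_lt with h' | h'
    · rwa [hx, ← h']
    · exact ext g hg x h' hxt ((hω.mono hy0 hyg.le h'.le le_rfl (by linarith)).trans_lt hy)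
  rcases hxt.eq_or_lt with h | h
  · rw [h] at hxG; exact hxG.2.2
  · obtain ⟨y, hxy, hyT, hy⟩ := hω.right_small x (by linarith) (by linarith) η hη
    have hlt : x < min y t := lt_min hxy h
    have := ext x hxG (min y t) hlt (min_le_right _ _)
      ((hω.mono (by linarith) le_rfl hlt.le (min_le_left _ _) hyT).trans_lt hy)
    exact absurd (le_csSup hbdd this) (not_le.2 hlt)

/-- On a fine partition the surplus power θ - 1 of each term is small, and superadditivity bounds
the sum of what remains by ω(s,t). -/
theorem exists_partition_sum_rpow_lt (hω : IsControl T ω) {s t : ℝ} (h0 : 0 ≤ s) (hst : s ≤ t)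
    (hT : t ≤ T) {θ : ℝ} (hθ : 1 < θ) {ε : ℝ} (hε : 0 < ε) :
    ∃ (N : ℕ) (u : ℕ → ℝ), IsPartition s t N u ∧
      ∑ i ∈ Finset.range N, ω (u i) (u (i + 1)) ^ θ < ε := by
  have hM : 0 ≤ ω s t := hω.nonneg s t h0 hst hT
  -- Solves η^(θ-1) (ω(s,t) + 1) = ε; the added 1 covers ω(s,t) = 0.
  set η : ℝ := (ε / (ω s t + 1)) ^ (1 / (θ - 1)) with hη_def
  have hη : 0 < η := by positivity
  obtain ⟨N, u, hu, hs⟩ := hω.exists_fine_partition h0 hst hT hη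
  refine ⟨N, u, hu, ?_⟩
  have hle : ∀ i ∈ Finset.range N,
      ω (u i) (u (i + 1)) ^ θ ≤ η ^ (θ - 1) * ω (u i) (u (i + 1)) := by
    intro i hi
    rw [Finset.mem_range] at hi
    have hn : 0 ≤ ω (u i) (u (i + 1)) := hω.nonneg _ _ (h0.trans (hu.left_le hi.le))
      (hu.2.2 i hi).le ((hu.le_right hi).trans hT)
    calc ω (u i) (u (i + 1)) ^ θ
        = ω (u i) (u (i + 1)) ^ (θ - 1) * ω (u i) (u (i + 1)) := by
          rw [← Real.rpow_add_one' hn (by linarith)]; congr 1; ring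
      _ ≤ _ := by
          gcongr
          exacts [(hs i hi).le]
  have hsum := hω.sum_le (N := N) (u := u) (hu.1 ▸ h0) (fun i hi => (hu.2.2 i hi).le)
    (hu.2.1 ▸ hT)
  rw [hu.1, hu.2.1] at hsum
  calc ∑ i ∈ Finset.range N, ω (u i) (u (i + 1)) ^ θ
      ≤ η ^ (θ - 1) * ∑ i ∈ Finset.range N, ω (u i) (u (i + 1)) := by
        rw [Finset.mul_sum]; exact Finset.sum_le_sum hle
    _ ≤ η ^ (θ - 1) * ω s t := by gcongr
    _ = ε / (ω s t + 1) * ω s t := by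
        rw [hη_def, ← Real.rpow_mul (by positivity), one_div_mul_cancel (by linarith),
          Real.rpow_one]
    _ < ε := by
        rw [div_mul_eq_mul_div, div_lt_iff₀ (by linarith)]
        nlinarith

theorem sum_additive {A : ℝ → ℝ → ℝ}
    (hA : ∀ s u t : ℝ, 0 ≤ s → s ≤ u → u ≤ t → t ≤ T → A s t = A s u + A u t)
    {s t : ℝ} (h0 : 0 ≤ s) (hT : t ≤ T) {N : ℕ} {u : ℕ → ℝ} (hu : IsPartition s t N u) :
    A s t = ∑ i ∈ Finset.range N, A (u i) (u (i + 1)) := by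
  have hst : s ≤ t := hu.2.1 ▸ hu.left_le le_rfl
  suffices ∀ n ≤ N, A s (u n) = ∑ i ∈ Finset.range n, A (u i) (u (i + 1)) by
    rw [← this N le_rfl, hu.2.1]
  intro n hn
  induction n with
  | zero =>
    have := hA s s s h0 le_rfl le_rfl (hst.trans hT)
    simp only [hu.1, Finset.range_zero, Finset.sum_empty]
    linarith
  | succ n ih =>
    rw [Finset.sum_range_succ, ← ih (by omega)]
    exact hA _ _ _ h0 (hu.left_le (by omega)) (hu.2.2 n (by omega)).le ((hu.le_right hn).trans hT)

/-- An additive function of intervals which is dominated by a power greater than one of a control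
vanishes. -/
theorem additive_eq_zero (hω : IsControl T ω) {A : ℝ → ℝ → ℝ}
    (hA : ∀ s u t : ℝ, 0 ≤ s → s ≤ u → u ≤ t → t ≤ T → A s t = A s u + A u t)
    {θ C : ℝ} (hθ : 1 < θ) (hC : 0 ≤ C)
    (hAω : ∀ s t : ℝ, 0 ≤ s → s ≤ t → t ≤ T → |A s t| ≤ C * ω s t ^ θ)
    {s t : ℝ} (h0 : 0 ≤ s) (hst : s ≤ t) (hT : t ≤ T) : A s t = 0 := by
  rw [← abs_eq_zero]
  refine le_antisymm (le_of_forall_pos_lt_add fun ε hε => ?_) (abs_nonneg _)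
  obtain ⟨N, u, hu, hlt⟩ := hω.exists_partition_sum_rpow_lt h0 hst hT hθ
    (show 0 < ε / (C + 1) by positivity)
  rw [sum_additive hA h0 hT hu, zero_add]
  calc _ ≤ ∑ i ∈ Finset.range N, |A (u i) (u (i + 1))| := Finset.abs_sum_le_sum_abs _ _
    _ ≤ ∑ i ∈ Finset.range N, C * ω (u i) (u (i + 1)) ^ θ := by
        refine Finset.sum_le_sum fun i hi => ?_
        rw [Finset.mem_range] at hi
        exact hAω _ _ (h0.trans (hu.left_le hi.le)) (hu.2.2 i hi).le ((hu.le_right hi).trans hT)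
    _ = C * ∑ i ∈ Finset.range N, ω (u i) (u (i + 1)) ^ θ := by rw [Finset.mul_sum]
    _ ≤ C * (ε / (C + 1)) := by gcongr
    _ < ε := by
        rw [← mul_div_assoc, div_lt_iff₀ (by linarith)]
        nlinarith

end IsControl

/-! ### The sewing lemma -/

/-- The constant of the sewing lemma. -/
def sewingConst (θ : ℝ) : ℝ := 2 / (1 - 2 * (1 / 2) ^ θ)

theorem two_mul_half_rpow_lt_one {θ : ℝ} (hθ : 1 < θ) : 2 * (1 / 2 : ℝ) ^ θ < 1 := by
  have := Real.rpow_lt_rpow_of_exponent_gt (x := 1 / 2) (by norm_num) (by norm_num) hθ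
  rw [Real.rpow_one] at this
  linarith

theorem sewingConst_pos {θ : ℝ} (hθ : 1 < θ) : 0 < sewingConst θ :=
  div_pos two_pos (by linarith [two_mul_half_rpow_lt_one hθ])

/-- Fixed point of the recursion in the maximal inequality: two applications of the defect bound,
plus two subintervals whose control is at most half. -/
theorem sewingConst_eq {θ : ℝ} (hθ : 1 < θ) :
    2 + 2 * (1 / 2) ^ θ * sewingConst θ = sewingConst θ := by
  have h : 1 - 2 * (1 / 2 : ℝ) ^ θ ≠ 0 := by linarith [two_mul_half_rpow_lt_one hθ]
  unfold sewingConst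
  field_simp
  ring

variable {T : ℝ} {ω : ℝ → ℝ → ℝ}

/-- The maximal inequality of the sewing lemma. -/
theorem IsControl.abs_sub_sum_le (hω : IsControl T ω) {θ C : ℝ} (hθ : 1 < θ) (hC : 0 ≤ C)
    {Ξ : ℝ → ℝ → ℝ} (hΞ : ∀ s u t : ℝ, 0 ≤ s → s ≤ u → u ≤ t → t ≤ T →
      |Ξ s t - Ξ s u - Ξ u t| ≤ C * ω s t ^ θ) (N : ℕ) (u : ℕ → ℝ) (h0 : 0 ≤ u 0)
    (hu : ∀ i < N, u i ≤ u (i + 1)) (hT : u N ≤ T) :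
    |Ξ (u 0) (u N) - ∑ i ∈ Finset.range N, Ξ (u i) (u (i + 1))|
      ≤ C * sewingConst θ * ω (u 0) (u N) ^ θ := by
  induction N using Nat.strong_induction_on generalizing u with
  | _ N ih =>
  have hm : ∀ j ≤ N, ∀ i ≤ j, u i ≤ u j := by
    intro j hj i hij
    induction j, hij using Nat.le_induction with
    | base => exact le_rfl
    | succ j _ ih => exact (ih (by omega)).trans (hu j (by omega))
  have hK := (sewingConst_pos hθ).le
  have hself : ∀ s, 0 ≤ s → s ≤ T → Ξ s s = 0 := by
    intro s hs hsT
    have := hΞ s s s hs le_rfl le_rfl hsT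
    rw [hω.self_eq_zero hs hsT, Real.zero_rpow (by linarith), mul_zero] at this
    have := abs_nonpos_iff.1 this
    linarith
  rcases Nat.eq_zero_or_pos N with rfl | hN
  · simp only [Finset.range_zero, Finset.sum_empty, sub_zero]
    rw [hself _ h0 hT, abs_zero, hω.self_eq_zero h0 hT, Real.zero_rpow (by linarith), mul_zero]
  set W := ω (u 0) (u N) with hW
  have hW0 : 0 ≤ W := hω.nonneg _ _ h0 (hm N le_rfl 0 (by omega)) hT
  -- Bisection in the sense of the control: j is the last index below N whose initial segment
  -- carries at most half of W. The segment up to j + 1, if not the whole, carries more than half,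
  -- so by superadditivity at most half is left after it. The straddling step from j to j + 1 is
  -- kept as it is.
  obtain ⟨j, hjN, hj1, hj2⟩ : ∃ j < N, ω (u 0) (u j) ≤ W / 2 ∧ ω (u (j + 1)) (u N) ≤ W / 2 := by
    classical
    let P : ℕ → Prop := fun j => ω (u 0) (u j) ≤ W / 2
    have hP0 : P 0 := by
      simp only [P]
      rw [hω.self_eq_zero h0 ((hm N le_rfl 0 (by omega)).trans hT)]
      positivity
    set j := Nat.findGreatest P (N - 1) with hj
    have hjle : j ≤ N - 1 := Nat.findGreatest_le _
    have hPj : P j := Nat.findGreatest_spec (Nat.zero_le _) hP0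
    refine ⟨j, by omega, hPj, ?_⟩
    rcases Nat.lt_or_ge (j + 1) N with hlt | hge
    · have hnot : ¬ P (j + 1) := Nat.findGreatest_is_greatest (lt_add_one _) (by omega)
      have := hω.superadd (u 0) (u (j + 1)) (u N) h0 (hm _ hlt.le 0 (by omega))
        (hm N le_rfl _ hlt.le) hT
      simp only [P, not_le] at hnot
      linarith
    · rw [show j + 1 = N by omega, hω.self_eq_zero (h0.trans (hm _ le_rfl 0 (by omega))) hT]
      positivity
  have hsplit : ∑ i ∈ Finset.range N, Ξ (u i) (u (i + 1))
      = ∑ i ∈ Finset.range j, Ξ (u i) (u (i + 1)) + Ξ (u j) (u (j + 1))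
        + ∑ i ∈ Finset.range (N - (j + 1)), Ξ (u (j + 1 + i)) (u (j + 1 + i + 1)) := by
    rw [← Finset.sum_range_succ (fun i => Ξ (u i) (u (i + 1))), ← Finset.sum_range_add]
    congr 2; omega
  have i1 := ih j hjN u h0 (fun i hi => hu i (by omega)) ((hm N le_rfl _ hjN.le).trans hT)
  have i2 := ih (N - (j + 1)) (by omega) (fun i => u (j + 1 + i))
    (h0.trans (hm _ (by omega) 0 (by omega))) (fun i hi => hu _ (by omega))
    (by simpa only [Nat.add_sub_cancel' hjN] using hT)
  simp only [add_zero, Nat.add_sub_cancel' hjN, ← add_assoc] at i2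
  have hj0 : 0 ≤ u j := h0.trans (hm j hjN.le 0 (by omega))
  have hjj : u j ≤ u (j + 1) := hu j hjN
  have d1 := hΞ (u 0) (u j) (u N) h0 (hm j hjN.le 0 (by omega)) (hm N le_rfl _ hjN.le) hT
  have d2 := hΞ (u j) (u (j + 1)) (u N) hj0 hjj (hm N le_rfl _ hjN) hT
  have b2 : C * ω (u j) (u N) ^ θ ≤ C * W ^ θ := by
    gcongr
    · exact hω.nonneg _ _ hj0 (hm N le_rfl _ hjN.le) hT
    · exact hω.mono h0 (hm j hjN.le 0 (by omega)) (hm N le_rfl _ hjN.le) le_rfl hT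
  have half : ∀ x, 0 ≤ x → x ≤ W / 2 →
      C * sewingConst θ * x ^ θ ≤ C * sewingConst θ * ((1 / 2) ^ θ * W ^ θ) := by
    intro x hx hxW
    rw [← Real.mul_rpow (by norm_num) hW0]
    gcongr
    linarith
  have c1 := i1.trans (half _ (hω.nonneg _ _ h0 (hm j hjN.le 0 (by omega))
    ((hm N le_rfl _ hjN.le).trans hT)) hj1)
  have c2 := i2.trans (half _ (hω.nonneg _ _ (hj0.trans hjj) (hm N le_rfl _ hjN) hT) hj2)
  have key : C * sewingConst θ * W ^ θ = 2 * (C * W ^ θ)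
      + 2 * (C * sewingConst θ * ((1 / 2) ^ θ * W ^ θ)) := by
    conv_lhs => rw [← sewingConst_eq hθ]
    ring
  rw [hsplit, key]
  rw [abs_le] at *
  constructor <;> linarith [d1.1, d1.2, d2.1, d2.2, c1.1, c1.2, c2.1, c2.2]

theorem IsControl.abs_sub_partition_sum_le (hω : IsControl T ω) {θ C : ℝ} (hθ : 1 < θ) (hC : 0 ≤ C)
    {Ξ : ℝ → ℝ → ℝ} (hΞ : ∀ s u t : ℝ, 0 ≤ s → s ≤ u → u ≤ t → t ≤ T →
      |Ξ s t - Ξ s u - Ξ u t| ≤ C * ω s t ^ θ) {s t : ℝ} {N : ℕ} {u : ℕ → ℝ}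
    (hu : IsPartition s t N u) (h0 : 0 ≤ s) (hT : t ≤ T) :
    |Ξ s t - ∑ i ∈ Finset.range N, Ξ (u i) (u (i + 1))| ≤ C * sewingConst θ * ω s t ^ θ := by
  have := hω.abs_sub_sum_le hθ hC hΞ N u (hu.1 ▸ h0) (fun i hi => (hu.2.2 i hi).le) (hu.2.1 ▸ hT)
  rwa [hu.1, hu.2.1] at this

/-- On finitely many times, the sums of Ξ over consecutive points already work; the maximal
inequality makes the constant independent of the set. -/
theorem IsControl.exists_sewing_finset (hω : IsControl T ω) {θ C : ℝ} (hθ : 1 < θ) (hC : 0 ≤ C)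
    {Ξ : ℝ → ℝ → ℝ} (hΞ : ∀ s u t : ℝ, 0 ≤ s → s ≤ u → u ≤ t → t ≤ T →
      |Ξ s t - Ξ s u - Ξ u t| ≤ C * ω s t ^ θ) (F : Finset ℝ) (hF : ∀ x ∈ F, 0 ≤ x ∧ x ≤ T) :
    ∃ Z : ℝ → ℝ, ∀ s ∈ F, ∀ t ∈ F, s ≤ t →
      |Z t - Z s - Ξ s t| ≤ C * sewingConst θ * ω s t ^ θ := by
  classical
  let e := F.orderEmbOfFin rfl
  let u : ℕ → ℝ := fun i => if h : i < F.card then e ⟨i, h⟩ else 0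
  have hu : ∀ i, ∀ h : i < F.card, u i = e ⟨i, h⟩ := fun i h => dif_pos h
  have hidx : ∀ x ∈ F, ∃ k < F.card, u k = x := by
    intro x hx
    have : x ∈ Set.range e := by rw [Finset.range_orderEmbOfFin]; exact hx
    obtain ⟨k, rfl⟩ := this
    exact ⟨k, k.2, hu _ _⟩
  choose! k hk hk' using hidx
  refine ⟨fun t => ∑ i ∈ Finset.range (k t), Ξ (u i) (u (i + 1)), fun s hs t ht hst => ?_⟩
  have hkk : k s ≤ k t := by
    by_contra! hlt
    have : u (k t) < u (k s) := by
      rw [hu _ (hk t ht), hu _ (hk s hs)]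
      exact e.strictMono hlt
    rw [hk' t ht, hk' s hs] at this
    linarith
  obtain ⟨m, hm⟩ := Nat.exists_eq_add_of_le hkk
  have := hω.abs_sub_sum_le hθ hC hΞ m (fun i => u (k s + i)) (by simpa [hk' s hs] using (hF s hs).1)
    (fun i hi => by
      have h1 := hk t ht
      rw [hu _ (by omega), hu _ (by omega)]
      exact e.monotone (by simp)) (by simpa [← hm, hk' t ht] using (hF t ht).2)
  simp only [add_zero, ← hm, hk' t ht, hk' s hs] at this
  beta_reduce
  rw [hm, Finset.sum_range_add, add_sub_cancel_left, abs_sub_comm]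
  simpa only [add_assoc] using this

/-- The sewing lemma. -/
theorem IsControl.exists_sewing (hω : IsControl T ω) {θ C : ℝ} (hθ : 1 < θ) (hC : 0 ≤ C)
    {Ξ : ℝ → ℝ → ℝ} (hΞ : ∀ s u t : ℝ, 0 ≤ s → s ≤ u → u ≤ t → t ≤ T →
      |Ξ s t - Ξ s u - Ξ u t| ≤ C * ω s t ^ θ) :
    ∃ Z : ℝ → ℝ, ∀ s t : ℝ, 0 ≤ s → s ≤ t → t ≤ T →
      |Z t - Z s - Ξ s t| ≤ C * sewingConst θ * ω s t ^ θ := by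
  classical
  have hfin : ∀ F : Finset ℝ, ∃ Z : ℝ → ℝ, Z 0 = 0 ∧ ∀ s ∈ F, ∀ t ∈ F, 0 ≤ s → s ≤ t → t ≤ T →
      |Z t - Z s - Ξ s t| ≤ C * sewingConst θ * ω s t ^ θ := by
    intro F
    obtain ⟨Z, hZ⟩ := hω.exists_sewing_finset hθ hC hΞ (F.filter fun x => 0 ≤ x ∧ x ≤ T)
      (fun x hx => (Finset.mem_filter.1 hx).2)
    refine ⟨fun t => Z t - Z 0, sub_self _, fun s hs t ht h0 hst hT => ?_⟩
    rw [sub_sub_sub_cancel_right]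
    exact hZ s (Finset.mem_filter.2 ⟨hs, h0, hst.trans hT⟩) t
      (Finset.mem_filter.2 ⟨ht, h0.trans hst, hT⟩) hst
  choose Z hZ0 hZ using hfin
  -- The limit over finite sets of times is taken along an ultrafilter, so boundedness suffices and
  -- no convergence of Riemann sums has to be shown. The normalisation Z 0 = 0 gives the bound, by
  -- comparison with time 0.
  let U : Ultrafilter (Finset ℝ) := Ultrafilter.of Filter.atTop
  have hU : (U : Filter (Finset ℝ)) ≤ Filter.atTop := Ultrafilter.of_le _
  have hlim : ∀ t, 0 ≤ t → t ≤ T → ∃ z, Filter.Tendsto (fun F => Z F t) U (nhds z) := by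
    intro t h0 hT
    set M := C * sewingConst θ * ω 0 t ^ θ with hM
    have hev : ∀ᶠ F in (U : Filter (Finset ℝ)), Z F t ∈ Set.Icc (Ξ 0 t - M) (Ξ 0 t + M) := by
      refine hU (Filter.mem_of_superset (Filter.mem_atTop {0, t}) fun F hF => ?_)
      have := hZ F 0 (hF (by simp)) t (hF (by simp)) le_rfl h0 hT
      rw [hZ0, sub_zero, abs_le] at this
      exact ⟨by linarith, by linarith⟩
    obtain ⟨z, -, hz⟩ := isCompact_Icc.ultrafilter_le_nhds (U.map fun F => Z F t)
      (Filter.le_principal_iff.2 hev)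
    exact ⟨z, hz⟩
  choose! z hz using hlim
  refine ⟨z, fun s t h0 hst hT => ?_⟩
  have h1 := ((hz t (h0.trans hst) hT).sub (hz s h0 (hst.trans hT))).sub_const (Ξ s t)
  refine le_of_tendsto h1.abs (hU (Filter.mem_of_superset (Filter.mem_atTop {s, t}) fun F hF => ?_))
  exact hZ F s (hF (by simp)) t (hF (by simp)) h0 hst hT

/-! ### The tensor product of tensor series -/

namespace TensorSeries

variable {ι : Type*}

/-- The left derivative of a tensor series along a letter. -/
def shift (x : ι) (a : TensorSeries ι) : TensorSeries ι := fun I => a (x :: I)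

@[simp] theorem shift_apply (x : ι) (a : TensorSeries ι) (I : List ι) :
    shift x a I = a (x :: I) := rfl

theorem shift_def (x : ι) (a : TensorSeries ι) : shift x a = fun I => a (x :: I) := rfl

/-- The part of the tensor product that comes from cutting a word into two non-empty words. -/
def mid (a b : TensorSeries ι) (I : List ι) : ℝ :=
  ∑ k ∈ Finset.Ico 1 I.length, a (I.take k) * b (I.drop k)

@[simp] theorem tmul_nil (a b : TensorSeries ι) : tmul a b [] = a [] * b [] := by simp [tmul]

theorem tmul_cons (a b : TensorSeries ι) (x : ι) (I : List ι) :
    tmul a b (x :: I) = tmul (shift x a) b I + a [] * b (x :: I) := by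
  simp [tmul, Finset.sum_range_succ' _ (I.length + 1)]

theorem tmul_smul_add (c : ℝ) (a a' b : TensorSeries ι) (I : List ι) :
    tmul (fun J => a J + c * a' J) b I = tmul a b I + c * tmul a' b I := by
  simp only [tmul, Finset.mul_sum, ← Finset.sum_add_distrib]
  exact Finset.sum_congr rfl fun k _ => by ring

theorem tmul_assoc (a b c : TensorSeries ι) : tmul (tmul a b) c = tmul a (tmul b c) := by
  funext I
  induction I generalizing a b with
  | nil => simp [mul_assoc]
  | cons x I ih =>
    have : shift x (tmul a b) = fun J => tmul (shift x a) b J + a [] * shift x b J := by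
      funext J; simp [tmul_cons]
    rw [tmul_cons, tmul_cons a, this, tmul_smul_add, ih, tmul_cons b, tmul_nil]
    ring

theorem tmul_eq_mid (a b : TensorSeries ι) {I : List ι} (hI : I ≠ []) :
    tmul a b I = a [] * b I + a I * b [] + mid a b I := by
  have hpos : 0 < I.length := List.length_pos_iff.2 hI
  rw [tmul, mid, Finset.range_eq_Ico, Finset.sum_Ico_succ_top (Nat.zero_le _),
    Finset.sum_eq_sum_Ico_succ_bot hpos]
  simp
  ring

theorem mid_congr {a a' b b' : TensorSeries ι} {I : List ι}
    (ha : ∀ J : List ι, J.length < I.length → a J = a' J)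
    (hb : ∀ J : List ι, J.length < I.length → b J = b' J) : mid a b I = mid a' b' I := by
  refine Finset.sum_congr rfl fun k hk => ?_
  rw [Finset.mem_Ico] at hk
  rw [ha _ (by rw [List.length_take]; omega), hb _ (by rw [List.length_drop]; omega)]

/-- Associativity read at the word I, where every term containing a full word cancels. Only shorter
words of `ab` and `bc` enter, so Chen's relation below the length of I suffices to sew the next
level. -/
theorem mid_cocycle {a b c ab bc : TensorSeries ι} {I : List ι} (hI : I ≠ [])
    (ha : a [] = 1) (hb : b [] = 1) (hc : c [] = 1)
    (hab : ∀ J : List ι, J.length < I.length → ab J = tmul a b J)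
    (hbc : ∀ J : List ι, J.length < I.length → bc J = tmul b c J) :
    mid a bc I - mid a b I - mid ab c I = - mid b c I := by
  have h := congrFun (tmul_assoc a b c) I
  rw [tmul_eq_mid (tmul a b) _ hI, tmul_eq_mid a (tmul b c) hI, tmul_eq_mid a b hI, tmul_eq_mid b c hI,
    ← mid_congr hab (fun _ _ => rfl), ← mid_congr (fun _ _ => rfl) hbc, tmul_nil, tmul_nil,
    ha, hb, hc] at h
  linarith

end TensorSeries

open TensorSeries

/-! ### Quasi-shuffles -/

section QuasiShuffle

variable {ι : Type*} (br : ι → ι → Option ι)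

/-- The words of the quasi-shuffle product of two words, where `br` is the partially defined
product of letters. -/
def quasiShuffle : List ι → List ι → List (List ι)
  | [], J => [J]
  | a :: I, [] => [a :: I]
  | a :: I, b :: J => (quasiShuffle I (b :: J)).map (a :: ·) ++
      (quasiShuffle (a :: I) J).map (b :: ·) ++
      (br a b).elim [] fun c => (quasiShuffle I J).map (c :: ·)
  termination_by I J => I.length + J.length

/-- The evaluation of a tensor series on the quasi-shuffle product of two words. -/
def qeval (a : TensorSeries ι) (I J : List ι) : ℝ := ((quasiShuffle br I J).map a).sum

@[simp] theorem qeval_nil_left (a : TensorSeries ι) (J : List ι) : qeval br a [] J = a J := by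
  simp [qeval, quasiShuffle]

@[simp] theorem qeval_nil_right (a : TensorSeries ι) (I : List ι) : qeval br a I [] = a I := by
  cases I <;> simp [qeval, quasiShuffle]

theorem qeval_cons_cons (a : TensorSeries ι) (x y : ι) (I J : List ι) :
    qeval br a (x :: I) (y :: J) = qeval br (shift x a) I (y :: J)
      + qeval br (shift y a) (x :: I) J
      + (br x y).elim 0 fun c => qeval br (shift c a) I J := by
  cases h : br x y <;> simp [qeval, quasiShuffle, h, Function.comp_def, shift_def, add_assoc]

theorem qeval_smul_add (c : ℝ) (a b : TensorSeries ι) (I J : List ι) :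
    qeval br (fun K => a K + c * b K) I J = qeval br a I J + c * qeval br b I J := by
  simp only [qeval]
  induction quasiShuffle br I J with
  | nil => simp
  | cons K l ih => simp only [List.map_cons, List.sum_cons, ih]; ring

theorem shift_tmul (a b : TensorSeries ι) (x : ι) :
    shift x (tmul a b) = fun J => tmul (shift x a) b J + a [] * shift x b J := by
  funext J; simp [tmul_cons]

/-- Deconcatenation is compatible with the quasi-shuffle product. -/
theorem qeval_tmul (a b : TensorSeries ι) (I J : List ι) :
    qeval br (tmul a b) I J = ∑ i ∈ Finset.range (I.length + 1), ∑ j ∈ Finset.range (J.length + 1),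
      qeval br a (I.take i) (J.take j) * qeval br b (I.drop i) (J.drop j) := by
  match I, J with
  | [], J => simp [tmul]
  | x :: I, [] => simp [tmul]
  | x :: I, y :: J =>
    -- Each left derivative of a product splits into a derivative of `a` times `b` and a term with
    -- factor `a []`. The latter recombine, over the three ways to choose a first letter, into the
    -- cut with both left pieces empty.
    rw [qeval_cons_cons, shift_tmul, shift_tmul, qeval_smul_add, qeval_smul_add,
      qeval_tmul (shift x a) b I (y :: J), qeval_tmul (shift y a) b (x :: I) J]
    have h3 : ((br x y).elim 0 fun c => qeval br (shift c (tmul a b)) I J)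
        = (∑ i ∈ Finset.range (I.length + 1), ∑ j ∈ Finset.range (J.length + 1),
            ((br x y).elim 0 fun c => qeval br (shift c a) (I.take i) (J.take j))
              * qeval br b (I.drop i) (J.drop j))
          + a [] * (br x y).elim 0 fun c => qeval br (shift c b) I J := by
      cases h : br x y with
      | none => simp
      | some c =>
        simp only [Option.elim_some]
        rw [shift_tmul, qeval_smul_add, qeval_tmul (shift c a) b I J]
    rw [h3]
    simp only [List.length_cons]
    simp only [Finset.sum_range_succ' _ (I.length + 1),
      Finset.sum_range_succ' _ (J.length + 1), List.take_succ_cons, List.drop_succ_cons,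
      List.take_zero, List.drop_zero, qeval_nil_left, qeval_nil_right, qeval_cons_cons br a,
      shift_apply, add_mul, Finset.sum_add_distrib]
    rw [qeval_cons_cons br b x y I J]
    ring
  termination_by I.length + J.length

/-- The weight of a word, for given weights of the letters. -/
def weight (w : ι → ℕ) (I : List ι) : ℕ := (I.map w).sum

@[simp] theorem weight_nil (w : ι → ℕ) : weight w [] = 0 := rfl

@[simp] theorem weight_cons (w : ι → ℕ) (x : ι) (I : List ι) :
    weight w (x :: I) = w x + weight w I := by simp [weight]

theorem weight_append (w : ι → ℕ) (I J : List ι) :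
    weight w (I ++ J) = weight w I + weight w J := by simp [weight]

theorem weight_take_add_drop (w : ι → ℕ) (I : List ι) (k : ℕ) :
    weight w (I.take k) + weight w (I.drop k) = weight w I := by
  rw [← weight_append, List.take_append_drop]

theorem length_le_weight {w : ι → ℕ} (hw : ∀ x, 1 ≤ w x) (I : List ι) :
    I.length ≤ weight w I := by
  induction I with
  | nil => simp
  | cons x I ih => have := hw x; simp; omega

theorem weight_one (I : List ι) : weight (fun _ => 1) I = I.length := by
  simp [weight]

/-- Homogeneity: both sides of the quasi-shuffle identity are bounded by the same power of the
control. -/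
theorem weight_of_mem_quasiShuffle {w : ι → ℕ}
    (hw : ∀ x y c, br x y = some c → w c = w x + w y) (I J : List ι) :
    ∀ K ∈ quasiShuffle br I J, weight w K = weight w I + weight w J := by
  match I, J with
  | [], J => simp [quasiShuffle]
  | x :: I, [] => simp [quasiShuffle]
  | x :: I, y :: J =>
    intro K hK
    have h1 := weight_of_mem_quasiShuffle hw I (y :: J)
    have h2 := weight_of_mem_quasiShuffle hw (x :: I) J
    have h3 := weight_of_mem_quasiShuffle hw I J
    simp only [quasiShuffle, List.mem_append, List.mem_map] at hK
    rcases hK with (⟨K, hK, rfl⟩ | ⟨K, hK, rfl⟩) | hK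
    · have := h1 K hK; simp at this ⊢; omega
    · have := h2 K hK; simp at this ⊢; omega
    · cases h : br x y with
      | none => simp [h] at hK
      | some c =>
        simp only [h, Option.elim_some, List.mem_map] at hK
        obtain ⟨K, hK, rfl⟩ := hK
        have := h3 K hK
        have := hw x y c h
        simp
        omega
  termination_by I.length + J.length

end QuasiShuffle

/-! ### Multiplicative functionals -/

/-- Multiplicative functionals with values in `T((ℝ^ι))`. -/
structure IsMultiplicative {ι : Type*} (T : ℝ) (S : ℝ → ℝ → TensorSeries ι) : Prop where
  nil : ∀ s t : ℝ, 0 ≤ s → s ≤ t → t ≤ T → S s t [] = 1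
  chen : ∀ s u t : ℝ, 0 ≤ s → s ≤ u → u ≤ t → t ≤ T → S s t = tmul (S s u) (S u t)

/-- The sums of `A` over suitable partitions of any interval are arbitrarily small. -/
def HasVanishingSums (T : ℝ) (A : ℝ → ℝ → ℝ) : Prop :=
  ∀ s t : ℝ, 0 ≤ s → s ≤ t → t ≤ T → ∀ ε > 0, ∃ (N : ℕ) (u : ℕ → ℝ), IsPartition s t N u ∧
    |∑ i ∈ Finset.range N, A (u i) (u (i + 1))| < ε

theorem IsControl.hasVanishingSums {T : ℝ} {ω : ℝ → ℝ → ℝ} (hω : IsControl T ω) {θ : ℝ}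
    (hθ : 1 < θ) {A : ℝ → ℝ → ℝ}
    (hA : ∀ s t : ℝ, 0 ≤ s → s ≤ t → t ≤ T → |A s t| ≤ ω s t ^ θ) : HasVanishingSums T A := by
  intro s t h0 hst hT ε hε
  obtain ⟨N, u, hu, hlt⟩ := hω.exists_partition_sum_rpow_lt h0 hst hT hθ hε
  refine ⟨N, u, hu, (Finset.abs_sum_le_sum_abs _ _).trans_lt (lt_of_le_of_lt ?_ hlt)⟩
  refine Finset.sum_le_sum fun i hi => ?_
  rw [Finset.mem_range] at hi
  exact hA _ _ (h0.trans (hu.left_le hi.le)) (hu.2.2 i hi).le ((hu.le_right hi).trans hT)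

variable {ι : Type*}

/-- Weights add up over a cut, so every product of bounds carries exactly the power of the whole
word. -/
theorem abs_mid_le {w : ι → ℕ} {p x y z : ℝ} (hp : 0 < p) (hx : 0 ≤ x) (hy : 0 ≤ y) (hxz : x ≤ z)
    (hyz : y ≤ z) {C : List ι → ℝ} {a b : TensorSeries ι} {I : List ι}
    (hC : ∀ J : List ι, J.length < I.length → 0 ≤ C J)
    (ha : ∀ J : List ι, J.length < I.length → |a J| ≤ C J * x ^ (weight w J / p))
    (hb : ∀ J : List ι, J.length < I.length → |b J| ≤ C J * y ^ (weight w J / p)) :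
    |mid a b I| ≤ (∑ k ∈ Finset.Ico 1 I.length, C (I.take k) * C (I.drop k))
      * z ^ (weight w I / p) := by
  rw [mid, Finset.sum_mul]
  refine (Finset.abs_sum_le_sum_abs _ _).trans (Finset.sum_le_sum fun k hk => ?_)
  rw [Finset.mem_Ico] at hk
  have h1 : (I.take k).length < I.length := by rw [List.length_take]; omega
  have h2 : (I.drop k).length < I.length := by rw [List.length_drop]; omega
  have hz : 0 ≤ z := hx.trans hxz
  have hw : z ^ (weight w I / p) = z ^ (weight w (I.take k) / p) * z ^ (weight w (I.drop k) / p) := by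
    rw [← Real.rpow_add_of_nonneg hz (by positivity) (by positivity), ← add_div,
      ← weight_take_add_drop w I k]
    push_cast
    rfl
  have c1 := hC _ h1
  have c2 := hC _ h2
  rw [abs_mul, hw]
  calc |a (I.take k)| * |b (I.drop k)|
      ≤ (C (I.take k) * x ^ (weight w (I.take k) / p))
        * (C (I.drop k) * y ^ (weight w (I.drop k) / p)) :=
        mul_le_mul (ha _ h1) (hb _ h2) (abs_nonneg _) (by positivity)
    _ ≤ (C (I.take k) * z ^ (weight w (I.take k) / p))
        * (C (I.drop k) * z ^ (weight w (I.drop k) / p)) := by gcongr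
    _ = _ := by ring

theorem IsMultiplicative.sub_sub_eq_mid {T : ℝ} {S : ℝ → ℝ → TensorSeries ι}
    (hS : IsMultiplicative T S) {s u t : ℝ} (h0 : 0 ≤ s) (hsu : s ≤ u) (hut : u ≤ t) (hT : t ≤ T)
    {I : List ι} (hI : I ≠ []) :
    S s t I - S s u I - S u t I = mid (S s u) (S u t) I := by
  rw [hS.chen s u t h0 hsu hut hT, tmul_eq_mid _ _ hI, hS.nil s u h0 hsu (hut.trans hT),
    hS.nil u t (h0.trans hsu) hut hT]
  ring

/-- The coordinates of a multiplicative functional on long words are controlled by those on short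
words, with constants which do not depend on the functional. -/
theorem exists_weighted_bound {w : ι → ℕ} {p : ℝ} (hp0 : 0 < p) (hp : p < 3)
    {C₀ : ℝ} (hC₀ : 0 ≤ C₀) (I : List ι) :
    ∃ C, 0 ≤ C ∧ ∀ (T : ℝ) (ω : ℝ → ℝ → ℝ) (S : ℝ → ℝ → TensorSeries ι), IsControl T ω →
      IsMultiplicative T S →
      (∀ J, weight w J ≤ 2 → ∀ s t : ℝ, 0 ≤ s → s ≤ t → t ≤ T →
        |S s t J| ≤ C₀ * ω s t ^ (weight w J / p)) →
      (∀ J, 3 ≤ weight w J → HasVanishingSums T fun s t => S s t J) →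
      ∀ s t : ℝ, 0 ≤ s → s ≤ t → t ≤ T → |S s t I| ≤ C * ω s t ^ (weight w I / p) := by
  induction hn : I.length using Nat.strong_induction_on generalizing I with
  | _ n ih =>
  rcases Nat.lt_or_ge 2 (weight w I) with h3 | h2
  swap
  · exact ⟨C₀, hC₀, fun T ω S _ _ h _ => h I h2⟩
  have ih' : ∀ J : List ι, J.length < I.length → _ := fun J hJ => ih J.length (hn ▸ hJ) J rfl
  choose! C hC0 hC using ih'
  have hI : I ≠ [] := by rintro rfl; simp at h3
  have hθ : 1 < (weight w I : ℝ) / p := by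
    rw [one_lt_div hp0]
    have : (3 : ℝ) ≤ weight w I := by exact_mod_cast h3
    linarith
  have hD : 0 ≤ ∑ k ∈ Finset.Ico 1 I.length, C (I.take k) * C (I.drop k) := by
    refine Finset.sum_nonneg fun k hk => ?_
    rw [Finset.mem_Ico] at hk
    exact mul_nonneg (hC0 _ (by rw [List.length_take]; omega))
      (hC0 _ (by rw [List.length_drop]; omega))
  refine ⟨_, mul_nonneg hD (sewingConst_pos hθ).le, fun T ω S hω hS h₁ h₂ s t h0 hst hT => ?_⟩
  refine le_of_forall_pos_lt_add fun ε hε => ?_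
  -- The maximal inequality compares the coordinate with its sum over any partition, and a partition
  -- with sum below ε leaves only the sewing bound.
  obtain ⟨N, u, hu, hlt⟩ := h₂ I h3 s t h0 hst hT ε hε
  have := hω.abs_sub_partition_sum_le (Ξ := fun s t => S s t I) hθ hD
    (fun s u t h0 hsu hut hT => ?_) hu h0 hT
  · have h' := abs_sub_abs_le_abs_sub (S s t I) (∑ i ∈ Finset.range N, S (u i) (u (i + 1)) I)
    linarith
  · rw [hS.sub_sub_eq_mid h0 hsu hut hT hI]
    exact abs_mid_le hp0 (hω.nonneg s u h0 hsu (hut.trans hT))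
      (hω.nonneg u t (h0.trans hsu) hut hT) (hω.mono h0 le_rfl hsu hut hT)
      (hω.mono h0 hsu hut le_rfl hT) hC0
      (fun J hJ => hC J hJ T ω S hω hS h₁ h₂ s u h0 hsu (hut.trans hT))
      (fun J hJ => hC J hJ T ω S hω hS h₁ h₂ u t (h0.trans hsu) hut hT)

/-- The defect of additivity over a partition. -/
theorem IsMultiplicative.eq_sum_add_sum_mid {T : ℝ} {S : ℝ → ℝ → TensorSeries ι}
    (hS : IsMultiplicative T S) {s t : ℝ} (h0 : 0 ≤ s) (hT : t ≤ T) {N : ℕ} {u : ℕ → ℝ}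
    (hu : IsPartition s t N u) {I : List ι} (hI : I ≠ []) :
    S s t I = ∑ i ∈ Finset.range N, S (u i) (u (i + 1)) I
      + ∑ i ∈ Finset.range N, mid (S s (u i)) (S (u i) (u (i + 1))) I + S s s I := by
  suffices ∀ n ≤ N, S s (u n) I = ∑ i ∈ Finset.range n, S (u i) (u (i + 1)) I
      + ∑ i ∈ Finset.range n, mid (S s (u i)) (S (u i) (u (i + 1))) I + S s s I by
    rw [← this N le_rfl, hu.2.1]
  intro n hn
  induction n with
  | zero => simp [hu.1]
  | succ n ih =>
    have := hS.sub_sub_eq_mid h0 (hu.left_le (by omega)) (hu.2.2 n (by omega)).le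
      ((hu.le_right hn).trans hT) hI
    rw [Finset.sum_range_succ, Finset.sum_range_succ]
    linarith [ih (by omega)]

open Filter Topology

/-! ### The control given by the variation of a two-parameter function -/

section PowVar

variable {E : Type*} [NormedAddCommGroup E]

/-- The `r`-th power of the `r`-variation. -/
def powVar (r : ℝ) (A : ℝ → ℝ → E) (s t : ℝ) : ℝ≥0∞ :=
  ⨆ (N : ℕ) (u : ℕ → ℝ) (_ : IsPartition s t N u),
    ∑ i ∈ Finset.range N, ‖A (u i) (u (i + 1))‖ₑ ^ r

theorem rVar_eq_powVar (r : ℝ) (A : ℝ → ℝ → E) (s t : ℝ) :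
    rVar r A s t = powVar r A s t ^ (1 / r) := rfl

theorem powVar_eq_rVar {r : ℝ} (hr : 0 < r) (A : ℝ → ℝ → E) (s t : ℝ) :
    powVar r A s t = rVar r A s t ^ r := by
  rw [rVar_eq_powVar, ← ENNReal.rpow_mul, one_div_mul_cancel hr.ne', ENNReal.rpow_one]

theorem powVar_lt_top_iff {r : ℝ} (hr : 0 < r) {A : ℝ → ℝ → E} {s t : ℝ} :
    powVar r A s t < ∞ ↔ rVar r A s t < ∞ := by
  rw [powVar_eq_rVar hr, ENNReal.rpow_lt_top_iff_of_pos hr]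

theorem sum_le_powVar (r : ℝ) (A : ℝ → ℝ → E) {s t : ℝ} {N : ℕ} {u : ℕ → ℝ}
    (hu : IsPartition s t N u) :
    ∑ i ∈ Finset.range N, ‖A (u i) (u (i + 1))‖ₑ ^ r ≤ powVar r A s t :=
  le_iSup_of_le N (le_iSup_of_le u (le_iSup_of_le hu le_rfl))

theorem enorm_rpow_le_powVar (r : ℝ) (A : ℝ → ℝ → E) {s t : ℝ} (h : s < t) :
    ‖A s t‖ₑ ^ r ≤ powVar r A s t := by
  simpa using sum_le_powVar r A (isPartition_pair h)

theorem exists_isPartition {s t : ℝ} (h : s ≤ t) : ∃ x : ℕ × (ℕ → ℝ), IsPartition s t x.1 x.2 := by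
  rcases h.eq_or_lt with rfl | h
  · exact ⟨(0, _), isPartition_refl s⟩
  · exact ⟨(1, _), isPartition_pair h⟩

theorem powVar_eq_biSup (r : ℝ) (A : ℝ → ℝ → E) (s t : ℝ) :
    powVar r A s t = ⨆ (x : ℕ × (ℕ → ℝ)) (_ : IsPartition s t x.1 x.2),
      ∑ i ∈ Finset.range x.1, ‖A (x.2 i) (x.2 (i + 1))‖ₑ ^ r := by
  rw [iSup_prod]; rfl

theorem powVar_superadd (r : ℝ) (A : ℝ → ℝ → E) {s u t : ℝ} (hsu : s ≤ u) (hut : u ≤ t) :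
    powVar r A s u + powVar r A u t ≤ powVar r A s t := by
  rw [powVar_eq_biSup r A s u, powVar_eq_biSup r A u t]
  refine ENNReal.biSup_add_biSup_le' (exists_isPartition hsu) (exists_isPartition hut)
    fun x hx y hy => ?_
  rw [← sum_concat (hx.2.1.trans hy.1.symm) fun a b => ‖A a b‖ₑ ^ r]
  exact sum_le_powVar r A (hx.concat hy)

theorem powVar_mono (r : ℝ) (A : ℝ → ℝ → E) {s s' t' t : ℝ} (h1 : s ≤ s') (h2 : s' ≤ t')
    (h3 : t' ≤ t) : powVar r A s' t' ≤ powVar r A s t :=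
  calc powVar r A s' t' ≤ powVar r A s s' + powVar r A s' t' := le_add_self
    _ ≤ powVar r A s t' := powVar_superadd r A h1 h2
    _ ≤ powVar r A s t' + powVar r A t' t := le_self_add
    _ ≤ _ := powVar_superadd r A (h1.trans h2) h3

theorem rVar_mono {r : ℝ} (hr : 0 < r) (A : ℝ → ℝ → E) {s s' t' t : ℝ} (h1 : s ≤ s') (h2 : s' ≤ t')
    (h3 : t' ≤ t) : rVar r A s' t' ≤ rVar r A s t :=
  ENNReal.rpow_le_rpow (powVar_mono r A h1 h2 h3) (by positivity)

theorem enorm_le_rVar {r : ℝ} (hr : 0 < r) (A : ℝ → ℝ → E) {s t : ℝ} (h : s < t) :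
    ‖A s t‖ₑ ≤ rVar r A s t := by
  rw [rVar_eq_powVar, one_div, ENNReal.le_rpow_inv_iff hr]
  exact enorm_rpow_le_powVar r A h

/-- A partition exceeding c still does so, by continuity, when its first point is moved slightly to
the right. -/
theorem exists_powVar_gt_right {r T : ℝ} {A : ℝ → ℝ → E}
    (hA : ContinuousOn (fun x : ℝ × ℝ => A x.1 x.2) (simplex T)) {m t : ℝ} (h0 : 0 ≤ m)
    (hmt : m < t) (hT : t ≤ T) {c : ℝ≥0∞} (hc : c < powVar r A m t) :
    ∃ v, m < v ∧ v < t ∧ c < powVar r A v t := by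
  simp only [powVar, lt_iSup_iff] at hc
  obtain ⟨N, u, hu, hlt⟩ := hc
  obtain ⟨M, rfl⟩ : ∃ M, N = M + 1 := by
    refine Nat.exists_eq_succ_of_ne_zero ?_
    rintro rfl
    linarith [hu.1, hu.2.1]
  have h1 : m < u 1 := hu.1 ▸ hu.2.2 0 (by omega)
  have h1t : u 1 ≤ t := hu.le_right (by omega)
  rw [Finset.sum_range_succ'] at hlt
  have hcont : Tendsto (fun v => ∑ i ∈ Finset.range M, ‖A (u (i + 1)) (u (i + 1 + 1))‖ₑ ^ r
      + ‖A v (u (0 + 1))‖ₑ ^ r) (𝓝[>] m)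
      (𝓝 (∑ i ∈ Finset.range M, ‖A (u (i + 1)) (u (i + 1 + 1))‖ₑ ^ r
        + ‖A (u 0) (u (0 + 1))‖ₑ ^ r)) := by
    refine tendsto_const_nhds.add ?_
    have hc : ContinuousWithinAt (fun x : ℝ × ℝ => A x.1 x.2) (simplex T) (m, u 1) :=
      hA _ ⟨h0, h1.le, h1t.trans hT⟩
    have hpt : Tendsto (fun v : ℝ => (v, u 1)) (𝓝[>] m) (𝓝[simplex T] (m, u 1)) := by
      refine tendsto_nhdsWithin_iff.2 ⟨?_, ?_⟩
      · exact ((continuous_id.prodMk continuous_const).tendsto m).mono_left nhdsWithin_le_nhds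
      · filter_upwards [Ioo_mem_nhdsGT h1] with v hv
        exact ⟨h0.trans hv.1.le, hv.2.le, h1t.trans hT⟩
    rw [hu.1]
    exact ((ENNReal.continuous_rpow_const.comp continuous_enorm).tendsto _).comp (hc.tendsto.comp hpt)
  obtain ⟨v, hv, hvm⟩ := ((hcont.eventually_const_lt hlt).and (Ioo_mem_nhdsGT h1)).exists
  have hpart : IsPartition v t (M + 1) (Function.update u 0 v) := by
    refine ⟨by simp, by simp [hu.2.1], fun i hi => ?_⟩
    rcases Nat.eq_zero_or_pos i with rfl | hi0
    · simpa using hvm.2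
    · rw [Function.update_of_ne hi0.ne', Function.update_of_ne (by omega)]
      exact hu.2.2 i hi
  refine ⟨v, hvm.1, hvm.2.trans_le h1t, hv.trans_le ?_⟩
  have := sum_le_powVar r A hpart
  rw [Finset.sum_range_succ'] at this
  simpa using this

theorem exists_powVar_gt_left {r T : ℝ} {A : ℝ → ℝ → E}
    (hA : ContinuousOn (fun x : ℝ × ℝ => A x.1 x.2) (simplex T)) {t m : ℝ} (h0 : 0 ≤ t)
    (htm : t < m) (hT : m ≤ T) {c : ℝ≥0∞} (hc : c < powVar r A t m) :
    ∃ v, t < v ∧ v < m ∧ c < powVar r A t v := by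
  simp only [powVar, lt_iSup_iff] at hc
  obtain ⟨N, u, hu, hlt⟩ := hc
  obtain ⟨M, rfl⟩ : ∃ M, N = M + 1 := by
    refine Nat.exists_eq_succ_of_ne_zero ?_
    rintro rfl
    linarith [hu.1, hu.2.1]
  have h1 : u M < m := hu.2.1 ▸ hu.2.2 M (by omega)
  have h1t : t ≤ u M := hu.left_le (by omega)
  rw [Finset.sum_range_succ] at hlt
  have hcont : Tendsto (fun v => ∑ i ∈ Finset.range M, ‖A (u i) (u (i + 1))‖ₑ ^ r
      + ‖A (u M) v‖ₑ ^ r) (𝓝[<] m)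
      (𝓝 (∑ i ∈ Finset.range M, ‖A (u i) (u (i + 1))‖ₑ ^ r + ‖A (u M) (u (M + 1))‖ₑ ^ r)) := by
    refine tendsto_const_nhds.add ?_
    have hc : ContinuousWithinAt (fun x : ℝ × ℝ => A x.1 x.2) (simplex T) (u M, m) :=
      hA _ ⟨h0.trans h1t, h1.le, hT⟩
    have hpt : Tendsto (fun v : ℝ => (u M, v)) (𝓝[<] m) (𝓝[simplex T] (u M, m)) := by
      refine tendsto_nhdsWithin_iff.2 ⟨?_, ?_⟩
      · exact ((continuous_const.prodMk continuous_id).tendsto m).mono_left nhdsWithin_le_nhds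
      · filter_upwards [Ioo_mem_nhdsLT h1] with v hv
        exact ⟨h0.trans h1t, hv.1.le, hv.2.le.trans hT⟩
    rw [hu.2.1]
    exact ((ENNReal.continuous_rpow_const.comp continuous_enorm).tendsto _).comp (hc.tendsto.comp hpt)
  obtain ⟨v, hv, hvm⟩ := ((hcont.eventually_const_lt hlt).and (Ioo_mem_nhdsLT h1)).exists
  have hpart : IsPartition t v (M + 1) (Function.update u (M + 1) v) := by
    refine ⟨by simp [hu.1], by simp, fun i hi => ?_⟩
    rcases Nat.lt_or_ge i M with hiM | hiM
    · rw [Function.update_of_ne (by omega), Function.update_of_ne (by omega)]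
      exact hu.2.2 i hi
    · obtain rfl : i = M := by omega
      rw [Function.update_of_ne (by omega), Function.update_self]
      exact hvm.1
  refine ⟨v, h1t.trans_lt hvm.1, hvm.2, hv.trans_le ?_⟩
  have := sum_le_powVar r A hpart
  rw [Finset.sum_range_succ, Function.update_self, Function.update_of_ne (by omega)] at this
  refine le_trans (le_of_eq ?_) this
  congr 1
  refine Finset.sum_congr rfl fun i hi => ?_
  rw [Finset.mem_range] at hi
  rw [Function.update_of_ne (by omega), Function.update_of_ne (by omega)]

/-- Superadditivity is concatenation of partitions. If the variation failed to vanish near an end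
point, infinitely many disjoint pieces of variation bounded below could be split off, contradicting
finiteness. -/
theorem isControl_powVar {r T : ℝ} {A : ℝ → ℝ → E}
    (hA : ContinuousOn (fun x : ℝ × ℝ => A x.1 x.2) (simplex T)) (hfin : powVar r A 0 T < ∞) :
    IsControl T fun s t => (powVar r A s t).toReal := by
  have hlt : ∀ {s t : ℝ}, 0 ≤ s → s ≤ t → t ≤ T → powVar r A s t ≠ ∞ := fun h0 hst hT =>
    ((powVar_mono r A h0 hst hT).trans_lt hfin).ne
  refine ⟨fun s t _ _ _ => ENNReal.toReal_nonneg, fun s u t h0 hsu hut hT => ?_,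
    fun m h0 hmT η hη => ?_, fun m h0 hmT η hη => ?_⟩
  · rw [← ENNReal.toReal_add (hlt h0 hsu (hut.trans hT)) (hlt (h0.trans hsu) hut hT)]
    exact ENNReal.toReal_mono (hlt h0 (hsu.trans hut) hT) (powVar_superadd r A hsu hut)
  · by_contra! hcon
    -- Halving η gives the strict inequality needed to move the left end point off m; the interval
    -- from m to v is then used again.
    have hn : ∀ n : ℕ, ∀ t, m < t → t ≤ T → n * ENNReal.ofReal (η / 2) ≤ powVar r A m t := by
      intro n
      induction n with
      | zero => simp
      | succ n ih =>
        intro t hmt ht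
        have hgt : ENNReal.ofReal (η / 2) < powVar r A m t := by
          rw [ENNReal.ofReal_lt_iff_lt_toReal (by positivity) (hlt h0 hmt.le ht)]
          linarith [hcon t hmt ht]
        obtain ⟨v, hv1, hv2, hv⟩ := exists_powVar_gt_right hA h0 hmt ht hgt
        calc ((n + 1 : ℕ) : ℝ≥0∞) * ENNReal.ofReal (η / 2)
            = n * ENNReal.ofReal (η / 2) + ENNReal.ofReal (η / 2) := by push_cast; ring
          _ ≤ powVar r A m v + powVar r A v t := add_le_add (ih v hv1 (hv2.le.trans ht)) hv.le
          _ ≤ _ := powVar_superadd r A hv1.le hv2.le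
    obtain ⟨n, hn'⟩ := ENNReal.exists_nat_mul_gt (a := ENNReal.ofReal (η / 2))
      (by simpa using hη) (hlt h0 hmT.le le_rfl)
    exact absurd hn' (not_lt.2 (hn n T hmT le_rfl))
  · by_contra! hcon
    have hn : ∀ n : ℕ, ∀ t, 0 ≤ t → t < m → n * ENNReal.ofReal (η / 2) ≤ powVar r A t m := by
      intro n
      induction n with
      | zero => simp
      | succ n ih =>
        intro t h0t hmt
        have hgt : ENNReal.ofReal (η / 2) < powVar r A t m := by
          rw [ENNReal.ofReal_lt_iff_lt_toReal (by positivity) (hlt h0t hmt.le hmT)]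
          linarith [hcon t h0t hmt]
        obtain ⟨v, hv1, hv2, hv⟩ := exists_powVar_gt_left hA h0t hmt hmT hgt
        calc ((n + 1 : ℕ) : ℝ≥0∞) * ENNReal.ofReal (η / 2)
            = ENNReal.ofReal (η / 2) + n * ENNReal.ofReal (η / 2) := by push_cast; ring
          _ ≤ powVar r A t v + powVar r A v m := add_le_add hv.le (ih v (h0t.trans hv1.le) hv2)
          _ ≤ _ := powVar_superadd r A hv1.le hv2.le
    obtain ⟨n, hn'⟩ := ENNReal.exists_nat_mul_gt (a := ENNReal.ofReal (η / 2))
      (by simpa using hη) (hlt le_rfl h0.le hmT)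
    exact absurd hn' (not_lt.2 (hn n 0 le_rfl h0))

theorem norm_le_powVar_rpow {r T : ℝ} (hr : 0 < r) {A : ℝ → ℝ → E} (hfin : powVar r A 0 T < ∞)
    {s t : ℝ} (h0 : 0 ≤ s) (hst : s ≤ t) (hT : t ≤ T) (hself : A s s = 0) :
    ‖A s t‖ ≤ (powVar r A s t).toReal ^ (1 / r) := by
  rcases hst.eq_or_lt with rfl | hlt
  · rw [hself, norm_zero]; positivity
  have h := enorm_le_rVar hr A hlt
  rw [rVar_eq_powVar] at h
  have := ENNReal.toReal_mono (ENNReal.rpow_ne_top_of_nonneg (by positivity)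
    ((powVar_mono r A h0 hst hT).trans_lt hfin).ne) h
  rwa [toReal_enorm, ← ENNReal.toReal_rpow] at this

theorem hasVanishingSums_of_rVar {r T : ℝ} (hr : 0 < r) (hr1 : r < 1) {A : ℝ → ℝ → ℝ}
    (hA : ContinuousOn (fun x : ℝ × ℝ => A x.1 x.2) (simplex T)) (hfin : rVar r A 0 T < ∞)
    (hself : ∀ s, 0 ≤ s → s ≤ T → A s s = 0) : HasVanishingSums T A := by
  rw [← powVar_lt_top_iff hr] at hfin
  exact (isControl_powVar hA hfin).hasVanishingSums (θ := 1 / r) (by rwa [one_lt_div hr])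
    fun s t h0 hst hT => norm_le_powVar_rpow hr hfin h0 hst hT (hself s h0 (hst.trans hT))

theorem rVar_le_of_norm_le {F : Type*} [NormedAddCommGroup F] {r : ℝ} (hr : 0 < r)
    {A : ℝ → ℝ → E} {B : ℝ → ℝ → F} (h : ∀ u v, ‖A u v‖ ≤ ‖B u v‖) (s t : ℝ) :
    rVar r A s t ≤ rVar r B s t := by
  refine ENNReal.rpow_le_rpow (iSup_mono fun N => iSup_mono fun u => iSup_mono fun _ =>
    Finset.sum_le_sum fun i _ => ENNReal.rpow_le_rpow ?_ hr.le) (by positivity)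
  exact enorm_le_iff_norm_le.2 (h _ _)

/-- Functions dominated by the power `1 / r` of a control have finite `r`-variation. -/
theorem rVar_lt_top_of_le {T : ℝ} {ω : ℝ → ℝ → ℝ} (hω : IsControl T ω) {r C : ℝ} (hr : 0 < r)
    (hC : 0 ≤ C) {A : ℝ → ℝ → E}
    (h : ∀ s t : ℝ, 0 ≤ s → s ≤ t → t ≤ T → ‖A s t‖ ≤ C * ω s t ^ (1 / r)) :
    rVar r A 0 T < ∞ := by
  rw [← powVar_lt_top_iff hr]
  refine lt_of_le_of_lt ?_ (ENNReal.ofReal_lt_top (r := C ^ r * ω 0 T))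
  refine iSup_le fun N => iSup_le fun u => iSup_le fun hu => ?_
  have hterm : ∀ i ∈ Finset.range N, 0 ≤ ω (u i) (u (i + 1)) ∧
      ‖A (u i) (u (i + 1))‖ₑ ^ r ≤ ENNReal.ofReal (C ^ r * ω (u i) (u (i + 1))) := by
    intro i hi
    rw [Finset.mem_range] at hi
    have hn := hω.nonneg _ _ (hu.left_le hi.le) (hu.2.2 i hi).le (hu.le_right hi)
    refine ⟨hn, ?_⟩
    have := h _ _ (hu.left_le hi.le) (hu.2.2 i hi).le (hu.le_right hi)
    rw [← ofReal_norm, ENNReal.ofReal_rpow_of_nonneg (norm_nonneg _) hr.le]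
    refine ENNReal.ofReal_le_ofReal ((Real.rpow_le_rpow (norm_nonneg _) this hr.le).trans ?_)
    rw [Real.mul_rpow hC (by positivity), ← Real.rpow_mul hn, one_div_mul_cancel hr.ne',
      Real.rpow_one]
  calc _ ≤ ∑ i ∈ Finset.range N, ENNReal.ofReal (C ^ r * ω (u i) (u (i + 1))) :=
        Finset.sum_le_sum fun i hi => (hterm i hi).2
    _ = ENNReal.ofReal (C ^ r * ∑ i ∈ Finset.range N, ω (u i) (u (i + 1))) := by
        rw [Finset.mul_sum, ENNReal.ofReal_sum_of_nonneg fun i hi =>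
          mul_nonneg (by positivity) (hterm i hi).1]
    _ ≤ _ := by
        refine ENNReal.ofReal_le_ofReal (mul_le_mul_of_nonneg_left ?_ (by positivity))
        have := hω.sum_le (N := N) (u := u) hu.1.ge (fun i hi => (hu.2.2 i hi).le) hu.2.1.le
        rwa [hu.1, hu.2.1] at this

end PowVar

/-! ### The control of a rough path -/

namespace RoughPath

variable {p T : ℝ} {ι : Type*} [Fintype ι]

theorem pos (X : RoughPath p T ι) : 0 < p := by linarith [X.two_le]

/-- The control `‖X‖_{p;[s,t]}^p + ‖𝕏‖_{p/2;[s,t]}^{p/2}` of a rough path. -/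
def control (X : RoughPath p T ι) (s t : ℝ) : ℝ :=
  (powVar p (incr X.path) s t).toReal + (powVar (p / 2) X.lift s t).toReal

theorem lift_self (X : RoughPath p T ι) {s : ℝ} (h0 : 0 ≤ s) (hT : s ≤ T) : X.lift s s = 0 := by
  ext ⟨i, j⟩
  have := X.chen s s s h0 le_rfl le_rfl hT i j
  simp only [incr, sub_self, PiLp.zero_apply, mul_zero, add_zero] at this ⊢
  linarith

theorem powVar_path_lt (X : RoughPath p T ι) : powVar p (incr X.path) 0 T < ∞ :=
  (powVar_lt_top_iff X.pos).2 X.path_rVar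

theorem powVar_lift_lt (X : RoughPath p T ι) : powVar (p / 2) X.lift 0 T < ∞ :=
  (powVar_lt_top_iff (half_pos X.pos)).2 X.lift_rVar

theorem isControl_control (X : RoughPath p T ι) : IsControl T X.control := by
  refine (isControl_powVar ?_ X.powVar_path_lt).add
    (isControl_powVar X.lift_continuousOn X.powVar_lift_lt)
  refine (X.path_continuousOn.comp continuousOn_snd fun x hx => ?_).sub
    (X.path_continuousOn.comp continuousOn_fst fun x hx => ?_)
  · exact ⟨hx.1.trans hx.2.1, hx.2.2⟩
  · exact ⟨hx.1, hx.2.1.trans hx.2.2⟩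

theorem abs_incr_le (X : RoughPath p T ι) {s t : ℝ} (h0 : 0 ≤ s) (hst : s ≤ t) (hT : t ≤ T)
    (i : ι) : |incr X.path s t i| ≤ X.control s t ^ (1 / p) := by
  have hp := X.pos
  refine ((Real.norm_eq_abs _).symm.le.trans (PiLp.norm_apply_le _ i)).trans
    ((norm_le_powVar_rpow hp X.powVar_path_lt h0 hst hT (by simp [incr])).trans ?_)
  refine Real.rpow_le_rpow ENNReal.toReal_nonneg ?_ (by positivity)
  exact le_add_of_nonneg_right ENNReal.toReal_nonneg

theorem abs_lift_le (X : RoughPath p T ι) {s t : ℝ} (h0 : 0 ≤ s) (hst : s ≤ t) (hT : t ≤ T)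
    (i j : ι) : |X.lift s t (i, j)| ≤ X.control s t ^ (2 / p) := by
  have hp := half_pos X.pos
  refine ((Real.norm_eq_abs _).symm.le.trans (PiLp.norm_apply_le _ (i, j))).trans
    ((norm_le_powVar_rpow hp X.powVar_lift_lt h0 hst hT (X.lift_self h0 (hst.trans hT))).trans ?_)
  rw [one_div_div]
  refine Real.rpow_le_rpow ENNReal.toReal_nonneg ?_ (by have := X.pos; positivity)
  exact le_add_of_nonneg_left ENNReal.toReal_nonneg

theorem rVar_sub_le_edist (X Y : RoughPath p T ι) :
    rVar p (fun s t => incr X.path s t - incr Y.path s t) 0 T ≤ edist X Y := le_self_add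

theorem rVar_lift_sub_le_edist (X Y : RoughPath p T ι) :
    rVar (p / 2) (fun s t => X.lift s t - Y.lift s t) 0 T ≤ edist X Y := le_add_self

/-- By the triangle inequality the r-variation is 1-Lipschitz for the rough path distance;
finiteness lets continuity pass to real values. -/
theorem continuous_rVar_aux {E : Type*} [NormedAddCommGroup E] {r : ℝ} (hr : 1 ≤ r)
    (A : RoughPath p T ι → ℝ → ℝ → E)
    (hA : ∀ X Y, rVar r (fun s t => A X s t - A Y s t) 0 T ≤ edist X Y)
    (hfin : ∀ X, powVar r (A X) 0 T < ∞)
    {s t : ℝ} (h0 : 0 ≤ s) (hst : s ≤ t) (hT : t ≤ T) :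
    Continuous fun X => (powVar r (A X) s t).toReal := by
  have hr0 : 0 < r := by linarith
  have hc : Continuous fun X => rVar r (A X) s t := by
    refine continuous_of_le_add_edist 1 ENNReal.one_ne_top fun X Y => ?_
    calc rVar r (A X) s t = rVar r (fun a b => A Y a b + (A X a b - A Y a b)) s t := by
          simp only [add_sub_cancel]
      _ ≤ rVar r (A Y) s t + rVar r (fun a b => A X a b - A Y a b) s t := rVar_add_le hr _ _ _ _
      _ ≤ _ := by
          rw [one_mul]
          gcongr
          exact (rVar_mono hr0 _ h0 hst hT).trans (hA X Y)
  have hc' : Continuous fun X => powVar r (A X) s t := by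
    simp only [powVar_eq_rVar hr0]
    exact ENNReal.continuous_rpow_const.comp hc
  refine continuous_iff_continuousAt.2 fun X => ?_
  exact (ENNReal.tendsto_toReal ((powVar_mono r _ h0 hst hT).trans_lt (hfin X)).ne).comp
    hc'.continuousAt

theorem continuous_control {s t : ℝ} (h0 : 0 ≤ s) (hst : s ≤ t) (hT : t ≤ T) :
    Continuous fun X : RoughPath p T ι => X.control s t := by
  -- A point is fixed only to extract 2 ≤ p from it.
  refine continuous_iff_continuousAt.2 fun X => ?_
  have h2 := X.two_le
  refine Continuous.continuousAt (.add ?_ ?_)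
  · exact continuous_rVar_aux (by linarith) (fun X => incr X.path) rVar_sub_le_edist
      powVar_path_lt h0 hst hT
  · exact continuous_rVar_aux (by linarith) lift rVar_lift_sub_le_edist
      powVar_lift_lt h0 hst hT

theorem continuous_incr {s t : ℝ} (h0 : 0 ≤ s) (hst : s ≤ t) (hT : t ≤ T) (i : ι) :
    Continuous fun X : RoughPath p T ι => incr X.path s t i := by
  rcases hst.eq_or_lt with rfl | hlt
  · simpa [incr] using continuous_const
  have : Continuous fun X : RoughPath p T ι => incr X.path s t := by
    refine (LipschitzWith.of_edist_le (fun X Y => ?_)).continuous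
    rw [edist_eq_enorm_sub]
    exact (enorm_le_rVar X.pos (fun s t => incr X.path s t - incr Y.path s t) hlt).trans
      ((rVar_mono X.pos _ h0 hst hT).trans (rVar_sub_le_edist X Y))
  exact (PiLp.continuous_apply 2 _ i).comp this

theorem continuous_lift {s t : ℝ} (h0 : 0 ≤ s) (hst : s ≤ t) (hT : t ≤ T) (i j : ι) :
    Continuous fun X : RoughPath p T ι => X.lift s t (i, j) := by
  rcases hst.eq_or_lt with rfl | hlt
  · simp only [lift_self _ h0 hT]
    exact continuous_const
  have : Continuous fun X : RoughPath p T ι => X.lift s t := by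
    refine (LipschitzWith.of_edist_le (fun X Y => ?_)).continuous
    rw [edist_eq_enorm_sub]
    exact (enorm_le_rVar (half_pos X.pos) (fun s t => X.lift s t - Y.lift s t) hlt).trans
      ((rVar_mono (half_pos X.pos) _ h0 hst hT).trans (rVar_lift_sub_le_edist X Y))
  exact (PiLp.continuous_apply 2 _ (i, j)).comp this

end RoughPath

/-! ### Lyons' extension -/

theorem IsControl.tendsto_right {T : ℝ} {ω : ℝ → ℝ → ℝ} (hω : IsControl T ω) {m : ℝ}
    (h0 : 0 ≤ m) (hT : m ≤ T) : Tendsto (fun t => ω m t) (𝓝[Set.Icc m T] m) (𝓝 0) := by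
  rcases hT.eq_or_lt with rfl | hlt
  · rw [Set.Icc_self, nhdsWithin_singleton]
    simpa [hω.self_eq_zero h0 le_rfl] using tendsto_pure_nhds (fun t => ω m t) m
  refine Metric.tendsto_nhds.2 fun η hη => ?_
  obtain ⟨t, h1, h2, h3⟩ := hω.right_small m h0 hlt η hη
  filter_upwards [self_mem_nhdsWithin, mem_nhdsWithin_of_mem_nhds (Iio_mem_nhds h1)] with x hx hxt
  rw [Real.dist_0_eq_abs, abs_of_nonneg (hω.nonneg m x h0 hx.1 hx.2)]
  exact (hω.mono h0 le_rfl hx.1 (le_of_lt hxt) h2).trans_lt h3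

theorem IsControl.tendsto_left {T : ℝ} {ω : ℝ → ℝ → ℝ} (hω : IsControl T ω) {m : ℝ}
    (h0 : 0 ≤ m) (hT : m ≤ T) : Tendsto (fun s => ω s m) (𝓝[Set.Icc 0 m] m) (𝓝 0) := by
  rcases h0.eq_or_lt with rfl | hlt
  · rw [Set.Icc_self, nhdsWithin_singleton]
    simpa [hω.self_eq_zero le_rfl hT] using tendsto_pure_nhds (fun s => ω s 0) 0
  refine Metric.tendsto_nhds.2 fun η hη => ?_
  obtain ⟨t, h1, h2, h3⟩ := hω.left_small m hlt hT η hη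
  filter_upwards [self_mem_nhdsWithin, mem_nhdsWithin_of_mem_nhds (Ioi_mem_nhds h2)] with x hx hxt
  rw [Real.dist_0_eq_abs, abs_of_nonneg (hω.nonneg x m hx.1 hx.2 hT)]
  exact (hω.mono h1 (le_of_lt hxt) hx.2 le_rfl hT).trans_lt h3

/-! ### Continuity and extension, level by level, of multiplicative functionals dominated by a
control. -/

section Multiplicative

variable {ι : Type*} {T : ℝ} {S : ℝ → ℝ → TensorSeries ι}

theorem IsMultiplicative.self_eq_zero (hS : IsMultiplicative T S) {s : ℝ} (h0 : 0 ≤ s) (hT : s ≤ T)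
    {I : List ι} (hI : I ≠ []) : S s s I = 0 := by
  induction hn : I.length using Nat.strong_induction_on generalizing I with
  | _ n ih =>
  have h := hS.sub_sub_eq_mid h0 le_rfl le_rfl hT hI
  have hmid : mid (S s s) (S s s) I = 0 := by
    refine Finset.sum_eq_zero fun k hk => ?_
    rw [Finset.mem_Ico] at hk
    have hk' : (I.take k).length = k := by rw [List.length_take]; omega
    rw [ih k (by omega) (List.length_pos_iff.1 (by omega)) hk', zero_mul]
  linarith

theorem continuousOn_mid {X : Type*} [TopologicalSpace X] {D : Set X} {a b : X → TensorSeries ι}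
    {I : List ι} (ha : ∀ J : List ι, J.length < I.length → ContinuousOn (fun x => a x J) D)
    (hb : ∀ J : List ι, J.length < I.length → ContinuousOn (fun x => b x J) D) :
    ContinuousOn (fun x => mid (a x) (b x) I) D := by
  refine continuousOn_finsetSum _ fun k hk => ?_
  rw [Finset.mem_Ico] at hk
  exact (ha _ (by rw [List.length_take]; omega)).mul (hb _ (by rw [List.length_drop]; omega))

/-- Multiplicative functionals which are dominated by a control are continuous. -/
theorem IsMultiplicative.continuousOn (hS : IsMultiplicative T S) {ω : ℝ → ℝ → ℝ}
    (hω : IsControl T ω) {p : ℝ} (hp : 0 < p)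
    (hb : ∀ I, ∃ C, ∀ s t : ℝ, 0 ≤ s → s ≤ t → t ≤ T → |S s t I| ≤ C * ω s t ^ (I.length / p))
    (I : List ι) : ContinuousOn (fun x : ℝ × ℝ => S x.1 x.2 I) (simplex T) := by
  induction hn : I.length using Nat.strong_induction_on generalizing I with
  | _ n ih =>
  rcases eq_or_ne I [] with rfl | hI
  · exact continuousOn_const.congr fun x hx => hS.nil _ _ hx.1 hx.2.1 hx.2.2
  have ih' : ∀ J : List ι, J.length < I.length → _ := fun J hJ => ih J.length (hn ▸ hJ) J rfl
  have hmid : ContinuousOn (fun x : ℝ × ℝ => mid (S 0 x.1) (S x.1 x.2) I) (simplex T) :=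
    continuousOn_mid (fun J hJ => (ih' J hJ).comp (f := fun x : ℝ × ℝ => (0, x.1))
      (by fun_prop) fun x hx => ⟨le_rfl, hx.1, hx.2.1.trans hx.2.2⟩) ih'
  have hmid0 : ∀ m, 0 ≤ m → m ≤ T → mid (S 0 m) (S m m) I = 0 := fun m h0 hT => by
    rw [← hS.sub_sub_eq_mid le_rfl h0 le_rfl hT hI, hS.self_eq_zero h0 hT hI]; simp
  obtain ⟨C, hC⟩ := hb I
  have hpos : 0 < (I.length : ℝ) / p :=
    div_pos (by exact_mod_cast List.length_pos_iff.2 hI) hp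
  have hsmall : ∀ {l : Filter ℝ} {φ ψ : ℝ → ℝ}, Tendsto (fun x => ω (φ x) (ψ x)) l (𝓝 0) →
      (∀ᶠ x in l, 0 ≤ φ x ∧ φ x ≤ ψ x ∧ ψ x ≤ T) → Tendsto (fun x => S (φ x) (ψ x) I) l (𝓝 0) := by
    intro l φ ψ hl hx
    have h1 : Tendsto (fun x => C * ω (φ x) (ψ x) ^ (I.length / p)) l (𝓝 0) := by
      have := (hl.rpow_const (p := I.length / p) (Or.inr hpos.le)).const_mul C
      rwa [Real.zero_rpow hpos.ne', mul_zero] at this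
    refine squeeze_zero_norm' ?_ h1
    filter_upwards [hx] with x hx
    exact hC _ _ hx.1 hx.2.1 hx.2.2
  -- The increment from m to t is S m t I plus a `mid` term: the first is small by the control
  -- bound, the second is continuous by induction and vanishes at t = m. The left side is similar.
  have hg : ContinuousOn (fun t => S 0 t I) (Set.Icc 0 T) := by
    intro m hm
    have hr : ContinuousWithinAt (fun t => S 0 t I) (Set.Icc m T) m := by
      have h1 := hsmall (hω.tendsto_right hm.1 hm.2)
        (by filter_upwards [self_mem_nhdsWithin] with x hx using ⟨hm.1, hx.1, hx.2⟩)
      have h2 : Tendsto (fun t => mid (S 0 m) (S m t) I) (𝓝[Set.Icc m T] m) (𝓝 0) := by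
        have := ((hmid (m, m) ⟨hm.1, le_rfl, hm.2⟩).tendsto).comp
          (tendsto_nhdsWithin_iff.2 ⟨((continuous_const.prodMk continuous_id).tendsto m).mono_left
            (nhdsWithin_le_nhds (s := Set.Icc m T)),
            by filter_upwards [self_mem_nhdsWithin] with x hx using ⟨hm.1, hx.1, hx.2⟩⟩)
        simpa [Function.comp_def, hmid0 m hm.1 hm.2] using this
      have h3 := (h1.add h2).const_add (S 0 m I)
      simp only [add_zero] at h3
      refine h3.congr' ?_
      filter_upwards [self_mem_nhdsWithin] with t ht
      rw [← hS.sub_sub_eq_mid le_rfl hm.1 ht.1 ht.2 hI]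
      ring
    have hl : ContinuousWithinAt (fun t => S 0 t I) (Set.Icc 0 m) m := by
      have h1 := hsmall (hω.tendsto_left hm.1 hm.2)
        (by filter_upwards [self_mem_nhdsWithin] with x hx using ⟨hx.1, hx.2, hm.2⟩)
      have h2 : Tendsto (fun s => mid (S 0 s) (S s m) I) (𝓝[Set.Icc 0 m] m) (𝓝 0) := by
        have := ((hmid (m, m) ⟨hm.1, le_rfl, hm.2⟩).tendsto).comp
          (tendsto_nhdsWithin_iff.2 ⟨((continuous_id.prodMk continuous_const).tendsto m).mono_left
            (nhdsWithin_le_nhds (s := Set.Icc 0 m)),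
            by filter_upwards [self_mem_nhdsWithin] with x hx using ⟨hx.1, hx.2, hm.2⟩⟩)
        simpa [Function.comp_def, hmid0 m hm.1 hm.2] using this
      have h3 := (h1.add h2).const_sub (S 0 m I)
      simp only [add_zero, sub_zero] at h3
      refine h3.congr' ?_
      filter_upwards [self_mem_nhdsWithin] with s hs
      rw [← hS.sub_sub_eq_mid le_rfl hs.1 hs.2 hm.2 hI]
      ring
    exact (hl.union hr).mono (Set.Icc_subset_Icc_union_Icc)
  -- Chen's relation over 0 ≤ s ≤ t expresses S s t I through the one-parameter function just
  -- treated and a `mid` term.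
  have h2 : ContinuousOn (fun x : ℝ × ℝ => S 0 x.2 I) (simplex T) :=
    hg.comp continuousOn_snd fun x hx => ⟨hx.1.trans hx.2.1, hx.2.2⟩
  have h1 : ContinuousOn (fun x : ℝ × ℝ => S 0 x.1 I) (simplex T) :=
    hg.comp continuousOn_fst fun x hx => ⟨hx.1, hx.2.1.trans hx.2.2⟩
  refine ((h2.sub h1).sub hmid).congr fun x hx => ?_
  simp only [Pi.sub_apply]
  rw [← hS.sub_sub_eq_mid le_rfl hx.1 hx.2.1 hx.2.2 hI]
  ring

/-- The conditions on a multiplicative functional, up to level `n`. -/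
structure IsPartialExtension (T p : ℝ) (ω : ℝ → ℝ → ℝ) (n : ℕ) (S : ℝ → ℝ → TensorSeries ι) :
    Prop where
  nil : ∀ s t : ℝ, 0 ≤ s → s ≤ t → t ≤ T → S s t [] = 1
  chen : ∀ I : List ι, I.length ≤ n → ∀ s u t : ℝ, 0 ≤ s → s ≤ u → u ≤ t → t ≤ T →
    S s t I = tmul (S s u) (S u t) I
  bound : ∀ I : List ι, I.length ≤ n → ∃ C, 0 ≤ C ∧ ∀ s t : ℝ, 0 ≤ s → s ≤ t → t ≤ T →
    |S s t I| ≤ C * ω s t ^ (I.length / p)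

theorem tmul_congr {a a' b b' : TensorSeries ι} {I : List ι}
    (ha : ∀ J : List ι, J.length ≤ I.length → a J = a' J)
    (hb : ∀ J : List ι, J.length ≤ I.length → b J = b' J) : tmul a b I = tmul a' b' I := by
  refine Finset.sum_congr rfl fun k _ => ?_
  rw [ha _ (by rw [List.length_take]; omega), hb _ (by rw [List.length_drop]; omega)]

/-- Extension of a multiplicative functional by one level. -/
theorem IsPartialExtension.exists_succ {p : ℝ} {ω : ℝ → ℝ → ℝ} (hω : IsControl T ω) (hp0 : 0 < p)
    {n : ℕ} (hn : p < n + 1) (hS : IsPartialExtension T p ω n S) :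
    ∃ S' : ℝ → ℝ → TensorSeries ι, IsPartialExtension T p ω (n + 1) S' ∧
      ∀ (s t : ℝ) (I : List ι), I.length ≤ n → S' s t I = S s t I := by
  choose! C hC0 hC using hS.bound
  have hmidb : ∀ I : List ι, I.length = n + 1 → ∀ s u t : ℝ, 0 ≤ s → s ≤ u → u ≤ t → t ≤ T →
      |mid (S s u) (S u t) I| ≤ (∑ k ∈ Finset.Ico 1 I.length, C (I.take k) * C (I.drop k))
        * ω s t ^ (I.length / p) := by
    intro I hI s u t h0 hsu hut hT
    have := abs_mid_le (w := fun _ => 1) hp0 (hω.nonneg s u h0 hsu (hut.trans hT))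
      (hω.nonneg u t (h0.trans hsu) hut hT) (hω.mono h0 le_rfl hsu hut hT)
      (hω.mono h0 hsu hut le_rfl hT) (C := C) (a := S s u) (b := S u t) (I := I)
      (fun J hJ => hC0 J (by omega))
      (fun J hJ => by rw [weight_one]; exact hC J (by omega) s u h0 hsu (hut.trans hT))
      (fun J hJ => by rw [weight_one]; exact hC J (by omega) u t (h0.trans hsu) hut hT)
    rwa [weight_one] at this
  have hcoc : ∀ I : List ι, I.length = n + 1 → ∀ s u t : ℝ, 0 ≤ s → s ≤ u → u ≤ t → t ≤ T →
      mid (S 0 s) (S s t) I - mid (S 0 s) (S s u) I - mid (S 0 u) (S u t) I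
        = - mid (S s u) (S u t) I := by
    intro I hI s u t h0 hsu hut hT
    have hsT := hsu.trans (hut.trans hT)
    exact mid_cocycle (List.length_pos_iff.1 (by omega)) (hS.nil 0 s le_rfl h0 hsT)
      (hS.nil s u h0 hsu (hut.trans hT)) (hS.nil u t (h0.trans hsu) hut hT)
      (fun J hJ => hS.chen J (by omega) 0 s u le_rfl h0 hsu (hut.trans hT))
      (fun J hJ => hS.chen J (by omega) s u t h0 hsu hut hT)
  have hD : ∀ I : List ι, I.length = n + 1 →
      0 ≤ ∑ k ∈ Finset.Ico 1 I.length, C (I.take k) * C (I.drop k) := by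
    intro I hI
    refine Finset.sum_nonneg fun k hk => ?_
    rw [Finset.mem_Ico] at hk
    exact mul_nonneg (hC0 _ (by rw [List.length_take]; omega))
      (hC0 _ (by rw [List.length_drop]; omega))
  have hθ : ∀ I : List ι, I.length = n + 1 → 1 < (I.length : ℝ) / p := by
    intro I hI
    rw [one_lt_div hp0, hI]
    exact_mod_cast hn
  -- If the extension existed, the increment of its coordinate S 0 t I would be this `mid` term plus
  -- S s t I, which has order |I|/p > 1. Sewing the `mid` term therefore recovers the coordinate Z
  -- started at 0, and the remainder defines S s t I.
  have hsew : ∀ I : List ι, I.length = n + 1 → ∃ Z : ℝ → ℝ, ∀ s t : ℝ, 0 ≤ s → s ≤ t → t ≤ T →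
      |Z t - Z s - mid (S 0 s) (S s t) I|
        ≤ (∑ k ∈ Finset.Ico 1 I.length, C (I.take k) * C (I.drop k))
          * sewingConst (I.length / p) * ω s t ^ (I.length / p) := by
    intro I hI
    refine hω.exists_sewing (hθ I hI) (hD I hI) fun s u t h0 hsu hut hT => ?_
    rw [hcoc I hI s u t h0 hsu hut hT, abs_neg]
    exact hmidb I hI s u t h0 hsu hut hT
  choose! Z hZ using hsew
  let S' : ℝ → ℝ → TensorSeries ι := fun s t I =>
    if I.length ≤ n then S s t I else Z I t - Z I s - mid (S 0 s) (S s t) I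
  have hle : ∀ (s t : ℝ) (I : List ι), I.length ≤ n → S' s t I = S s t I :=
    fun s t I hI => if_pos hI
  refine ⟨S', ⟨fun s t h0 hst hT => ?_, fun I hI s u t h0 hsu hut hT => ?_, fun I hI => ?_⟩, hle⟩
  · rw [hle _ _ _ (Nat.zero_le _), hS.nil s t h0 hst hT]
  · rcases Nat.lt_or_ge n I.length with hlt | hge
    swap
    · rw [hle _ _ _ hge, hS.chen I hge s u t h0 hsu hut hT]
      exact (tmul_congr (fun J hJ => hle _ _ _ (hJ.trans hge))
        fun J hJ => hle _ _ _ (hJ.trans hge)).symm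
    have hI' : I.length = n + 1 := by omega
    have hne : I ≠ [] := List.length_pos_iff.1 (by omega)
    have hv : ∀ s t, S' s t I = Z I t - Z I s - mid (S 0 s) (S s t) I :=
      fun s t => if_neg (by omega)
    rw [tmul_eq_mid _ _ hne, hle _ _ [] (Nat.zero_le _), hle _ _ [] (Nat.zero_le _),
      hS.nil s u h0 hsu (hut.trans hT), hS.nil u t (h0.trans hsu) hut hT, hv, hv, hv,
      mid_congr (fun J hJ => hle s u J (by omega)) (fun J hJ => hle u t J (by omega))]
    linarith [hcoc I hI' s u t h0 hsu hut hT]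
  · rcases Nat.lt_or_ge n I.length with hlt | hge
    swap
    · exact ⟨C I, hC0 I hge, fun s t h0 hst hT => by
        rw [hle _ _ _ hge]; exact hC I hge s t h0 hst hT⟩
    have hI' : I.length = n + 1 := by omega
    refine ⟨_, mul_nonneg (hD I hI') (sewingConst_pos (hθ I hI')).le, fun s t h0 hst hT => ?_⟩
    have hv : S' s t I = Z I t - Z I s - mid (S 0 s) (S s t) I := if_neg (by omega)
    rw [hv]
    exact hZ I hI' s t h0 hst hT

/-- Extension of a multiplicative functional to all levels. -/
theorem IsPartialExtension.exists_extension {p : ℝ} {ω : ℝ → ℝ → ℝ} (hω : IsControl T ω)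
    (hp0 : 0 < p) {n : ℕ} (hn : p < n + 1) (hS : IsPartialExtension T p ω n S) :
    ∃ S' : ℝ → ℝ → TensorSeries ι, IsMultiplicative T S' ∧
      (∀ I : List ι, ∃ C, 0 ≤ C ∧ ∀ s t : ℝ, 0 ≤ s → s ≤ t → t ≤ T →
        |S' s t I| ≤ C * ω s t ^ (I.length / p)) ∧
      ∀ (s t : ℝ) (I : List ι), I.length ≤ n → S' s t I = S s t I := by
  have hk : ∀ k : ℕ, p < ((n + k : ℕ) : ℝ) + 1 := fun k => by push_cast; linarith [k.cast_nonneg (α := ℝ)]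
  -- Stage k settles words of length up to n + k, so a word I may be read at stage |I|.
  let F : ∀ k : ℕ, {R : ℝ → ℝ → TensorSeries ι // IsPartialExtension T p ω (n + k) R} :=
    fun k => Nat.rec ⟨S, hS⟩ (fun k R => ⟨_, (R.2.exists_succ hω hp0 (hk k)).choose_spec.1⟩) k
  have hF : ∀ (k : ℕ) (s t : ℝ) (I : List ι), I.length ≤ n + k →
      (F (k + 1)).1 s t I = (F k).1 s t I := fun k =>
    ((F k).2.exists_succ hω hp0 (hk k)).choose_spec.2
  have hFle : ∀ (k l : ℕ), k ≤ l → ∀ (s t : ℝ) (I : List ι), I.length ≤ n + k →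
      (F l).1 s t I = (F k).1 s t I := by
    intro k l hkl s t I hI
    induction l, hkl using Nat.le_induction with
    | base => rfl
    | succ l hl ih => rw [hF l s t I (by omega), ih]
  have hdiag : ∀ (k : ℕ) (s t : ℝ) (I : List ι), I.length ≤ k →
      (F I.length).1 s t I = (F k).1 s t I := fun k s t I hI =>
    (hFle _ _ hI s t I (by omega)).symm
  refine ⟨fun s t I => (F I.length).1 s t I, ⟨fun s t h0 hst hT => ?_,
    fun s u t h0 hsu hut hT => ?_⟩, fun I => ?_, fun s t I hI => hFle 0 _ (Nat.zero_le _) s t I hI⟩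
  · exact (F 0).2.nil s t h0 hst hT
  · funext I
    rw [(F I.length).2.chen I (by omega) s u t h0 hsu hut hT]
    exact tmul_congr (fun J hJ => (hdiag _ _ _ _ hJ).symm) fun J hJ => (hdiag _ _ _ _ hJ).symm
  · exact (F I.length).2.bound I (by omega)

theorem level_get (a : TensorSeries ι) (I : List ι) : level I.length a I.get = a I := by
  simp [level]

end Multiplicative

/-! ### Existence, uniqueness and continuity of Lyons' extension. -/

section Lyons

variable {p T : ℝ} {ι : Type*} [Fintype ι]

theorem IsLyonsExtension.isMultiplicative {X : RoughPath p T ι} {S : ℝ → ℝ → TensorSeries ι}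
    (hS : IsLyonsExtension X S) : IsMultiplicative T S :=
  ⟨fun s t h0 hst hT => hS.level_zero s t ⟨h0, hst, hT⟩, hS.chen⟩

/-- Level k ≥ 3 has finite variation of exponent p/k < 1. -/
theorem IsLyonsExtension.hasVanishingSums {X : RoughPath p T ι} {S : ℝ → ℝ → TensorSeries ι}
    (hS : IsLyonsExtension X S) {I : List ι} (hI : 3 ≤ I.length) :
    HasVanishingSums T fun s t => S s t I := by
  have hpos : (0 : ℝ) < I.length := by exact_mod_cast (by omega : 0 < I.length)
  have h3 : (3 : ℝ) ≤ I.length := by exact_mod_cast hI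
  have hr : 0 < p / I.length := div_pos X.pos hpos
  refine hasVanishingSums_of_rVar hr (by rw [div_lt_one hpos]; linarith [X.lt_three]) ?_ ?_ ?_
  · have := (PiLp.continuous_apply 2 (fun _ : Fin I.length → ι => ℝ) I.get).comp_continuousOn
      (hS.continuousOn I.length)
    simpa only [Function.comp_def, level_get] using this
  · refine (rVar_le_of_norm_le hr (fun u v => ?_) 0 T).trans_lt (hS.rVar_lt I.length (by omega))
    rw [← level_get (S u v) I]
    exact PiLp.norm_apply_le _ _
  · exact fun s h0 hT => hS.isMultiplicative.self_eq_zero h0 hT (List.length_pos_iff.1 (by omega))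

theorem IsLyonsExtension.abs_le_of_length_le {X : RoughPath p T ι} {S : ℝ → ℝ → TensorSeries ι}
    (hS : IsLyonsExtension X S) {I : List ι} (hI : I.length ≤ 2) {s t : ℝ} (h0 : 0 ≤ s)
    (hst : s ≤ t) (hT : t ≤ T) : |S s t I| ≤ X.control s t ^ (I.length / p) := by
  match I, hI with
  | [], _ => simp [hS.level_zero s t ⟨h0, hst, hT⟩]
  | [i], _ => simpa [hS.level_one s t ⟨h0, hst, hT⟩ i] using X.abs_incr_le h0 hst hT i
  | [i, j], _ => simpa [hS.level_two s t ⟨h0, hst, hT⟩ i j] using X.abs_lift_le h0 hst hT i j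

/-- The weighted bound with all weights 1. Its constant does not depend on the rough path, which
later makes approximations locally uniform. -/
theorem exists_lyons_bound (hp0 : 0 < p) (hp : p < 3) (I : List ι) :
    ∃ C, 0 ≤ C ∧ ∀ (X : RoughPath p T ι) (S : ℝ → ℝ → TensorSeries ι), IsLyonsExtension X S →
      ∀ s t : ℝ, 0 ≤ s → s ≤ t → t ≤ T → |S s t I| ≤ C * X.control s t ^ (I.length / p) := by
  obtain ⟨C, hC, h⟩ := exists_weighted_bound (w := fun _ => 1) hp0 hp zero_le_one I
  refine ⟨C, hC, fun X S hS s t h0 hst hT => ?_⟩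
  have := h T X.control S X.isControl_control hS.isMultiplicative (fun J hJ s t h0 hst hT => ?_)
    (fun J hJ => ?_) s t h0 hst hT
  · rwa [weight_one] at this
  · rw [weight_one] at hJ ⊢
    rw [one_mul]
    exact hS.abs_le_of_length_le hJ h0 hst hT
  · rw [weight_one] at hJ
    exact hS.hasVanishingSums hJ

/-- By induction both extensions have the same defect of additivity at I, so their difference is
additive; for |I| ≥ 3 it is of order ω^(|I|/p) with |I|/p > 1. -/
theorem IsLyonsExtension.unique {X : RoughPath p T ι} {S S' : ℝ → ℝ → TensorSeries ι}
    (hS : IsLyonsExtension X S) (hS' : IsLyonsExtension X S') (I : List ι) {s t : ℝ} (h0 : 0 ≤ s)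
    (hst : s ≤ t) (hT : t ≤ T) : S s t I = S' s t I := by
  induction hn : I.length using Nat.strong_induction_on generalizing I s t with
  | _ n ih =>
  rcases Nat.lt_or_ge 2 I.length with h3 | h2
  swap
  · match I, h2 with
    | [], _ => rw [hS.level_zero s t ⟨h0, hst, hT⟩, hS'.level_zero s t ⟨h0, hst, hT⟩]
    | [i], _ => rw [hS.level_one s t ⟨h0, hst, hT⟩, hS'.level_one s t ⟨h0, hst, hT⟩]
    | [i, j], _ => rw [hS.level_two s t ⟨h0, hst, hT⟩, hS'.level_two s t ⟨h0, hst, hT⟩]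
  have hI : I ≠ [] := List.length_pos_iff.1 (by omega)
  obtain ⟨C, hC, h⟩ := exists_lyons_bound (T := T) X.pos X.lt_three I
  have hθ : 1 < (I.length : ℝ) / p := by
    rw [one_lt_div X.pos]
    have : (3 : ℝ) ≤ I.length := by exact_mod_cast h3
    linarith [X.lt_three]
  have hz := X.isControl_control.additive_eq_zero (A := fun s t => S s t I - S' s t I)
    (C := 2 * C) (θ := I.length / p) (fun s u t h0 hsu hut hT => ?_) hθ (by positivity)
    (fun s t h0 hst hT => ?_) h0 hst hT
  · linarith
  · have e1 := hS.isMultiplicative.sub_sub_eq_mid h0 hsu hut hT hI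
    have e2 := hS'.isMultiplicative.sub_sub_eq_mid h0 hsu hut hT hI
    have e3 : mid (S s u) (S u t) I = mid (S' s u) (S' u t) I :=
      mid_congr (fun J hJ => ih J.length (hn ▸ hJ) J h0 hsu (hut.trans hT) rfl)
        (fun J hJ => ih J.length (hn ▸ hJ) J (h0.trans hsu) hut hT rfl)
    linarith
  · have := h X S hS s t h0 hst hT
    have := h X S' hS' s t h0 hst hT
    have := abs_sub (S s t I) (S' s t I)
    linarith

/-- The truncated signature at level two. -/
def levelTwo (X : RoughPath p T ι) (s t : ℝ) : TensorSeries ι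
  | [] => 1
  | [i] => incr X.path s t i
  | [i, j] => X.lift s t (i, j)
  | _ => 0

theorem isPartialExtension_levelTwo (X : RoughPath p T ι) :
    IsPartialExtension T p X.control 2 (levelTwo X) where
  nil s t _ _ _ := rfl
  chen I hI s u t h0 hsu hut hT := by
    match I, hI with
    | [], _ => simp [levelTwo]
    | [i], _ => simp [tmul_cons, levelTwo, incr]
    | [i, j], _ =>
      simp only [tmul_cons, tmul_nil, shift_apply, levelTwo, X.chen s u t h0 hsu hut hT i j]
      ring
  bound I hI := by
    refine ⟨1, zero_le_one, fun s t h0 hst hT => ?_⟩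
    rw [one_mul]
    match I, hI with
    | [], _ => simp [levelTwo]
    | [i], _ => simpa [levelTwo] using X.abs_incr_le h0 hst hT i
    | [i, j], _ => simpa [levelTwo] using X.abs_lift_le h0 hst hT i j

theorem norm_level_le (n : ℕ) (a : TensorSeries ι) :
    ‖level n a‖ ≤ ∑ w : Fin n → ι, |a (List.ofFn w)| := by
  classical
  rw [EuclideanSpace.norm_eq]
  refine Real.sqrt_le_iff.2 ⟨Finset.sum_nonneg fun _ _ => abs_nonneg _, ?_⟩
  simp only [level, Real.norm_eq_abs]
  exact Finset.sum_sq_le_sq_sum_of_nonneg fun _ _ => abs_nonneg _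

theorem exists_isLyonsExtension (X : RoughPath p T ι) : ∃ S, IsLyonsExtension X S := by
  have hω := X.isControl_control
  obtain ⟨S, hS, hb, hle⟩ := (isPartialExtension_levelTwo X).exists_extension hω X.pos
    (by norm_num; linarith [X.lt_three])
  refine ⟨S, ⟨fun s t h => hS.nil s t h.1 h.2.1 h.2.2, fun s t _ i => hle s t [i] (by simp),
    fun s t _ i j => hle s t [i, j] (by simp), hS.chen, fun n => ?_, fun n hn => ?_⟩⟩
  · have hc := hS.continuousOn hω X.pos fun I => (hb I).imp fun C h => h.2
    exact (PiLp.continuous_toLp 2 _).comp_continuousOn (continuousOn_pi.2 fun w => hc _)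
  · choose C hC0 hC using hb
    have hn' : (0 : ℝ) < n := by exact_mod_cast hn
    refine rVar_lt_top_of_le hω (C := ∑ w : Fin n → ι, C (List.ofFn w)) (div_pos X.pos hn')
      (Finset.sum_nonneg fun _ _ => hC0 _) fun s t h0 hst hT => ?_
    refine (norm_level_le n _).trans ?_
    rw [Finset.sum_mul, one_div_div]
    refine Finset.sum_le_sum fun w _ => ?_
    simpa using hC (List.ofFn w) s t h0 hst hT

theorem isLyonsExtension_signature (X : RoughPath p T ι) : IsLyonsExtension X (signature X) := by
  have h := exists_isLyonsExtension X
  rw [signature, dif_pos h]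
  exact h.choose_spec

/-- The coordinates of the signature are continuous in the rough path. -/
theorem continuous_signature (hp0 : 0 < p) (hp : p < 3) (I : List ι) {s t : ℝ} (h0 : 0 ≤ s)
    (hst : s ≤ t) (hT : t ≤ T) : Continuous fun X : RoughPath p T ι => signature X s t I := by
  induction hn : I.length using Nat.strong_induction_on generalizing I s t with
  | _ n ih =>
  have hL := isLyonsExtension_signature (p := p) (T := T) (ι := ι)
  rcases Nat.lt_or_ge 2 I.length with h3 | h2
  swap
  · match I, h2 with
    | [], _ => simpa only [(hL _).level_zero s t ⟨h0, hst, hT⟩] using continuous_const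
    | [i], _ =>
      simpa only [(hL _).level_one s t ⟨h0, hst, hT⟩] using RoughPath.continuous_incr h0 hst hT i
    | [i, j], _ =>
      simpa only [(hL _).level_two s t ⟨h0, hst, hT⟩] using RoughPath.continuous_lift h0 hst hT i j
  have hI : I ≠ [] := List.length_pos_iff.1 (by omega)
  obtain ⟨C, hC, h⟩ := exists_lyons_bound (T := T) hp0 hp I
  have hθ : 1 < (I.length : ℝ) / p := by
    rw [one_lt_div hp0]
    have : (3 : ℝ) ≤ I.length := by exact_mod_cast h3
    linarith
  refine continuous_iff_continuousAt.2 fun X => ?_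
  -- With a partition chosen for X, the coordinate is a sum of `mid` terms, continuous by induction,
  -- plus its own partition sum. The latter is at most C times the sum of powers of the control,
  -- which is continuous in the rough path and so stays small near X.
  refine continuousAt_of_locally_uniform_approx_of_continuousAt fun V hV => ?_
  obtain ⟨ε, hε, hεV⟩ := Metric.mem_uniformity_dist.1 hV
  obtain ⟨N, u, hu, hlt⟩ := X.isControl_control.exists_partition_sum_rpow_lt h0 hst hT hθ
    (show 0 < ε / (C + 1) by positivity)
  have hcoord : ∀ i ∈ Finset.range N, 0 ≤ u i ∧ u i ≤ u (i + 1) ∧ u (i + 1) ≤ T := fun i hi => by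
    rw [Finset.mem_range] at hi
    exact ⟨h0.trans (hu.left_le hi.le), (hu.2.2 i hi).le, (hu.le_right hi).trans hT⟩
  have hcc : Continuous fun Y : RoughPath p T ι =>
      ∑ i ∈ Finset.range N, Y.control (u i) (u (i + 1)) ^ ((I.length : ℝ) / p) := by
    refine continuous_finsetSum _ fun i hi => ?_
    obtain ⟨a, b, c⟩ := hcoord i hi
    exact (RoughPath.continuous_control a b c).rpow_const fun _ => Or.inr (by linarith)
  refine ⟨_, hcc.continuousAt.eventually_lt_const hlt, fun Y =>
    ∑ i ∈ Finset.range N, mid (signature Y s (u i)) (signature Y (u i) (u (i + 1))) I,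
    Continuous.continuousAt ?_, fun Y hY => hεV ?_⟩
  · refine continuous_finsetSum _ fun i hi => ?_
    obtain ⟨a, b, c⟩ := hcoord i hi
    have hsu : s ≤ u i := hu.left_le (Finset.mem_range.1 hi).le
    rw [← continuousOn_univ]
    exact continuousOn_mid
      (fun J hJ => (ih J.length (hn ▸ hJ) J h0 hsu (b.trans c) rfl).continuousOn)
      (fun J hJ => (ih J.length (hn ▸ hJ) J a b c rfl).continuousOn)
  · have hm := (hL Y).isMultiplicative
    beta_reduce
    rw [hm.eq_sum_add_sum_mid h0 hT hu hI, hm.self_eq_zero h0 (hst.trans hT) hI, add_zero,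
      Real.dist_eq, add_sub_cancel_right]
    calc _ ≤ ∑ i ∈ Finset.range N, |signature Y (u i) (u (i + 1)) I| :=
          Finset.abs_sum_le_sum_abs _ _
      _ ≤ ∑ i ∈ Finset.range N, C * Y.control (u i) (u (i + 1)) ^ ((I.length : ℝ) / p) := by
          refine Finset.sum_le_sum fun i hi => ?_
          obtain ⟨a, b, c⟩ := hcoord i hi
          exact h Y _ (hL Y) _ _ a b c
      _ = C * ∑ i ∈ Finset.range N, Y.control (u i) (u (i + 1)) ^ ((I.length : ℝ) / p) := by
          rw [Finset.mul_sum]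
      _ ≤ C * (ε / (C + 1)) := by
          gcongr
          exact le_of_lt hY
      _ < ε := by
          rw [← mul_div_assoc, div_lt_iff₀ (by linarith)]
          nlinarith

end Lyons

/-! ### Products of coordinates of multiplicative functionals -/

theorem abs_list_sum_le {α : Type*} {l : List α} {a C : α → ℝ} {x : ℝ}
    (h : ∀ K ∈ l, |a K| ≤ C K * x) : |(l.map a).sum| ≤ (l.map C).sum * x := by
  induction l with
  | nil => simp
  | cons K l ih =>
    simp only [List.map_cons, List.sum_cons, add_mul]
    exact (abs_add_le _ _).trans (add_le_add (h K (by simp)) (ih fun K hK => h K (by simp [hK])))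

section Weighted

variable {ι : Type*} {T p : ℝ} {ω : ℝ → ℝ → ℝ} {w : ι → ℕ} {S : ℝ → ℝ → TensorSeries ι}

/-- The quasi-shuffle identity for multiplicative functionals: it holds if it holds on the
words of total weight at most two. -/
theorem IsMultiplicative.mul_eq_qeval (hS : IsMultiplicative T S) (hω : IsControl T ω)
    (hp0 : 0 < p) (hp : p < 3)
    (hb : ∀ I, ∃ C, 0 ≤ C ∧ ∀ s t : ℝ, 0 ≤ s → s ≤ t → t ≤ T →
      |S s t I| ≤ C * ω s t ^ (weight w I / p))
    {br : ι → ι → Option ι} (hw : ∀ x y c, br x y = some c → w c = w x + w y)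
    (hlow : ∀ I J, I ≠ [] → J ≠ [] → weight w I + weight w J ≤ 2 → ∀ s t : ℝ, 0 ≤ s → s ≤ t →
      t ≤ T → S s t I * S s t J = qeval br (S s t) I J)
    (I J : List ι) {s t : ℝ} (h0 : 0 ≤ s) (hst : s ≤ t) (hT : t ≤ T) :
    S s t I * S s t J = qeval br (S s t) I J := by
  induction hn : I.length + J.length using Nat.strong_induction_on generalizing I J s t with
  | _ n ih =>
  rcases eq_or_ne I [] with rfl | hI
  · rw [hS.nil s t h0 hst hT, one_mul, qeval_nil_left]
  rcases eq_or_ne J [] with rfl | hJ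
  · rw [hS.nil s t h0 hst hT, mul_one, qeval_nil_right]
  rcases Nat.lt_or_ge 2 (weight w I + weight w J) with h3 | h2
  swap
  · exact hlow I J hI hJ h2 s t h0 hst hT
  choose C hC0 hC using hb
  have hθ : 1 < ((weight w I + weight w J : ℕ) : ℝ) / p := by
    rw [one_lt_div hp0]
    have : (3 : ℝ) ≤ ((weight w I + weight w J : ℕ) : ℝ) := by exact_mod_cast h3
    linarith
  have hsumC : 0 ≤ ((quasiShuffle br I J).map C).sum :=
    List.sum_nonneg fun x hx => by
      obtain ⟨K, -, rfl⟩ := List.mem_map.1 hx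
      exact hC0 K
  have hz := hω.additive_eq_zero (A := fun s t => S s t I * S s t J - qeval br (S s t) I J)
    (C := C I * C J + ((quasiShuffle br I J).map C).sum) (fun s u t h0 hsu hut hT => ?_) hθ
    (add_nonneg (mul_nonneg (hC0 I) (hC0 J)) hsumC)
    (fun s t h0 hst hT => ?_) h0 hst hT
  · linarith
  · have hI0 : 0 < I.length := List.length_pos_iff.2 hI
    have hn1 := hS.nil s u h0 hsu (hut.trans hT)
    have hn2 := hS.nil u t (h0.trans hsu) hut hT
    rw [hS.chen s u t h0 hsu hut hT, qeval_tmul]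
    simp only [tmul]
    rw [Finset.sum_mul_sum, ← Finset.sum_sub_distrib]
    simp only [← Finset.sum_sub_distrib]
    -- Among the pairs of cuts, the two extreme ones give the contributions of [s,u] and [u,t]. For
    -- all others both pairs of pieces are shorter in total, and the terms cancel by induction.
    rw [← Finset.sum_product', Finset.sum_eq_add (I.length, J.length) (0, 0)]
    · simp [hn1, hn2]
    · simp [hI]
    · rintro ⟨i, j⟩ hij ⟨h1, h2⟩
      simp only [Finset.mem_product, Finset.mem_range, ne_eq, Prod.mk.injEq] at hij h1 h2
      have e1 := ih _ (by simp only [List.length_take]; omega) (I.take i) (J.take j) h0 hsu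
        (hut.trans hT) rfl
      have e2 := ih _ (by simp only [List.length_drop]; omega) (I.drop i) (J.drop j)
        (h0.trans hsu) hut hT rfl
      rw [← e1, ← e2]
      ring
    · simp
    · simp
  · have hn := hω.nonneg s t h0 hst hT
    have hmul : |S s t I * S s t J|
        ≤ C I * C J * ω s t ^ (((weight w I + weight w J : ℕ) : ℝ) / p) := by
      rw [abs_mul]
      refine (mul_le_mul (hC I s t h0 hst hT) (hC J s t h0 hst hT) (abs_nonneg _)
        (mul_nonneg (hC0 I) (by positivity))).trans (le_of_eq ?_)
      push_cast
      rw [add_div, Real.rpow_add_of_nonneg hn (by positivity) (by positivity)]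
      ring
    have hq : |qeval br (S s t) I J| ≤ ((quasiShuffle br I J).map C).sum
        * ω s t ^ (((weight w I + weight w J : ℕ) : ℝ) / p) := by
      refine abs_list_sum_le fun K hK => ?_
      rw [← weight_of_mem_quasiShuffle br hw I J K hK]
      exact hC K s t h0 hst hT
    have := abs_sub (S s t I * S s t J) (qeval br (S s t) I J)
    rw [add_mul]
    linarith

/-! ### Integration against time -/

theorem IsMultiplicative.sub_eq_sum (hS : IsMultiplicative T S) {u v : ℝ} (h0 : 0 ≤ u)
    (huv : u ≤ v) (hT : v ≤ T) (I : List ι) :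
    S 0 v I - S 0 u I = ∑ k ∈ Finset.range I.length, S 0 u (I.take k) * S u v (I.drop k) := by
  rw [hS.chen 0 u v le_rfl h0 huv hT, tmul, Finset.sum_range_succ]
  simp [hS.nil u v h0 huv hT]

theorem exists_bound_of_le_weight (hω : IsControl T ω) (hp0 : 0 < p)
    (hb : ∀ I, ∃ C, 0 ≤ C ∧ ∀ s t : ℝ, 0 ≤ s → s ≤ t → t ≤ T →
      |S s t I| ≤ C * ω s t ^ (weight w I / p)) {I : List ι} {m : ℕ} (hm : m ≤ weight w I) :
    ∃ C, 0 ≤ C ∧ ∀ s t : ℝ, 0 ≤ s → s ≤ t → t ≤ T → |S s t I| ≤ C * ω s t ^ (m / p) := by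
  obtain ⟨C, hC0, hC⟩ := hb I
  rcases le_or_gt 0 T with hT0 | hT0
  swap
  · exact ⟨0, le_rfl, fun s t _ _ _ => by linarith⟩
  have hW := hω.nonneg 0 T le_rfl hT0 le_rfl
  obtain ⟨k, hk⟩ := Nat.exists_eq_add_of_le hm
  refine ⟨C * ω 0 T ^ (k / p), by positivity, fun s t h0 hst hT => (hC s t h0 hst hT).trans ?_⟩
  have hn := hω.nonneg s t h0 hst hT
  rw [hk]
  push_cast
  rw [add_div, Real.rpow_add_of_nonneg hn (by positivity) (by positivity), mul_assoc,
    mul_comm (ω s t ^ (m / p))]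
  gcongr
  exact hω.mono le_rfl h0 hst hT le_rfl

theorem exists_bound_sum (hω : IsControl T ω) (hp0 : 0 < p)
    (hb : ∀ I, ∃ C, 0 ≤ C ∧ ∀ s t : ℝ, 0 ≤ s → s ≤ t → t ≤ T →
      |S s t I| ≤ C * ω s t ^ (weight w I / p)) {m : ℕ} (a b : ℕ → List ι) (n : ℕ)
    (hm : ∀ k < n, m ≤ weight w (b k)) :
    ∃ C, 0 ≤ C ∧ ∀ u v : ℝ, 0 ≤ u → u ≤ v → v ≤ T →
      |∑ k ∈ Finset.range n, S 0 u (a k) * S u v (b k)| ≤ C * ω u v ^ (m / p) := by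
  induction n with
  | zero => exact ⟨0, le_rfl, by simp⟩
  | succ n ih =>
    obtain ⟨C, hC0, hC⟩ := ih fun k hk => hm k (by omega)
    obtain ⟨C₁, hC₁0, hC₁⟩ := exists_bound_of_le_weight hω hp0 hb (Nat.zero_le (weight w (a n)))
    obtain ⟨C₂, hC₂0, hC₂⟩ := exists_bound_of_le_weight hω hp0 hb (hm n (by omega))
    refine ⟨C + C₁ * C₂, by positivity, fun u v h0 huv hT => ?_⟩
    rw [Finset.sum_range_succ, add_mul]
    refine (abs_add_le _ _).trans (add_le_add (hC u v h0 huv hT) ?_)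
    have h1 := hC₁ 0 u le_rfl h0 (huv.trans hT)
    simp only [Nat.cast_zero, zero_div, Real.rpow_zero, mul_one] at h1
    rw [abs_mul, mul_assoc]
    exact mul_le_mul h1 (hC₂ u v h0 huv hT) (abs_nonneg _) hC₁0

/-- Appending a time letter to a word amounts to integration in time. -/
theorem IsMultiplicative.eq_integral (hS : IsMultiplicative T S) (hω : IsControl T ω)
    (hp0 : 0 < p) (hp : p < 3)
    (hb : ∀ I, ∃ C, 0 ≤ C ∧ ∀ s t : ℝ, 0 ≤ s → s ≤ t → t ≤ T →
      |S s t I| ≤ C * ω s t ^ (weight w I / p))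
    (hw : ∀ x, 1 ≤ w x) {τ : ι} (hwτ : w τ = 2)
    (hτ : ∀ s t : ℝ, 0 ≤ s → s ≤ t → t ≤ T → S s t [τ] = t - s)
    {J : List ι} (hc : ContinuousOn (fun r => S 0 r J) (Set.Icc 0 T)) {t : ℝ} (h0 : 0 ≤ t)
    (hT : t ≤ T) : S 0 t (J ++ [τ]) = ∫ r in (0 : ℝ)..t, S 0 r J := by
  have hint : ∀ u v : ℝ, 0 ≤ u → u ≤ v → v ≤ T →
      IntervalIntegrable (fun r => S 0 r J) MeasureTheory.volume u v := by
    intro u v hu huv hv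
    refine ContinuousOn.intervalIntegrable (hc.mono ?_)
    rw [Set.uIcc_of_le huv]
    exact Set.Icc_subset_Icc hu hv
  obtain ⟨C₁, hC₁0, hC₁⟩ := exists_bound_sum (m := 3) hω hp0 hb (fun k => J.take k)
    (fun k => J.drop k ++ [τ]) J.length fun k hk => by
      have h1 := length_le_weight hw (J.drop k)
      rw [List.length_drop] at h1
      rw [weight_append, weight_cons, weight_nil, hwτ]
      omega
  obtain ⟨C₂, hC₂0, hC₂⟩ := exists_bound_sum (m := 1) hω hp0 hb (fun k => J.take k)
    (fun k => J.drop k) J.length fun k hk => by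
      have h1 := length_le_weight hw (J.drop k)
      rw [List.length_drop] at h1
      omega
  obtain ⟨C₃, hC₃0, hC₃⟩ := hb [τ]
  simp only [weight_cons, weight_nil, hwτ, add_zero] at hC₃
  have hθ : (1 : ℝ) < 3 / p := by rwa [one_lt_div hp0]
  -- Both sides equal S 0 u J (v - u) up to order 3/p > 1. `C₁` bounds the words keeping a letter of
  -- J besides time, of weight at least 3; `C₂ * C₃` bounds the oscillation of the integrand, of
  -- order 1/p, times v - u, of order 2/p.
  have hz := hω.additive_eq_zero
    (A := fun u v => S 0 v (J ++ [τ]) - S 0 u (J ++ [τ]) - ∫ r in u..v, S 0 r J)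
    (C := C₁ + C₂ * C₃) (fun s u t h0 hsu hut hT => ?_) hθ (by positivity)
    (fun u v h0 huv hT => ?_) le_rfl h0 hT
  · rw [hS.self_eq_zero le_rfl (h0.trans hT) (by simp)] at hz
    linarith
  · rw [← intervalIntegral.integral_add_adjacent_intervals (hint s u h0 hsu (hut.trans hT))
      (hint u t (h0.trans hsu) hut hT)]
    ring
  · have hn := hω.nonneg u v h0 huv hT
    have hsum : S 0 v (J ++ [τ]) - S 0 u (J ++ [τ])
        = ∑ k ∈ Finset.range J.length, S 0 u (J.take k) * S u v (J.drop k ++ [τ])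
          + S 0 u J * (v - u) := by
      rw [hS.sub_eq_sum h0 huv hT, List.length_append, List.length_singleton,
        Finset.sum_range_succ]
      congr 1
      · refine Finset.sum_congr rfl fun k hk => ?_
        rw [Finset.mem_range] at hk
        rw [List.take_append_of_le_length hk.le, List.drop_append_of_le_length hk.le]
      · simp [hτ u v h0 huv hT]
    have hdiff : |∫ r in u..v, (S 0 r J - S 0 u J)| ≤ C₂ * C₃ * ω u v ^ ((3 : ℝ) / p) := by
      have h1 : ‖∫ r in u..v, (S 0 r J - S 0 u J)‖ ≤ C₂ * ω u v ^ ((1 : ℝ) / p) * |v - u| := by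
        refine intervalIntegral.norm_integral_le_of_norm_le_const fun r hr => ?_
        rw [Set.uIoc_of_le huv] at hr
        rw [hS.sub_eq_sum h0 hr.1.le (hr.2.trans hT), Real.norm_eq_abs]
        refine (hC₂ u r h0 hr.1.le (hr.2.trans hT)).trans ?_
        rw [Nat.cast_one]
        gcongr
        · exact hω.nonneg u r h0 hr.1.le (hr.2.trans hT)
        · exact hω.mono h0 le_rfl hr.1.le hr.2 hT
      have h2 := hC₃ u v h0 huv hT
      rw [hτ u v h0 huv hT] at h2
      refine h1.trans ((mul_le_mul_of_nonneg_left h2 (by positivity)).trans (le_of_eq ?_))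
      rw [show (3 : ℝ) / p = 1 / p + ((2 : ℕ) : ℝ) / p by rw [← add_div]; norm_num,
        Real.rpow_add_of_nonneg hn (by positivity) (by positivity)]
      ring
    have hint' : ∫ r in u..v, (S 0 r J - S 0 u J) = (∫ r in u..v, S 0 r J) - S 0 u J * (v - u) := by
      rw [intervalIntegral.integral_sub (hint u v h0 huv hT) intervalIntegrable_const,
        intervalIntegral.integral_const, smul_eq_mul]
      ring
    have h3 := hC₁ u v h0 huv hT
    rw [Nat.cast_ofNat] at h3
    rw [hint'] at hdiff
    rw [hsum, add_mul]
    rw [abs_le] at *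
    constructor <;> linarith [h3.1, h3.2, hdiff.1, hdiff.2]

end Weighted

/-! ### Functions determined by their iterated integrals -/

/-- Repeated integration by parts: each one lowers the power of T - r and raises the index of G. The
boundary terms vanish because G (j + 1) is zero at both ends. -/
theorem integral_mul_pow_eq_zero {T : ℝ} (hT : 0 ≤ T) {G : ℕ → ℝ → ℝ}
    (hc : ∀ k, ContinuousOn (G k) (Set.Icc 0 T))
    (hG : ∀ k, ∀ t ∈ Set.Icc 0 T, G (k + 1) t = ∫ r in (0 : ℝ)..t, G k r)
    (hGT : ∀ k, G k T = 0) (k j : ℕ) : ∫ r in (0 : ℝ)..T, G j r * (T - r) ^ k = 0 := by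
  induction k generalizing j with
  | zero => simp only [pow_zero, mul_one]; rw [← hG j T ⟨hT, le_rfl⟩, hGT]
  | succ k ih =>
    have hv : ∀ x : ℝ, HasDerivAt (fun r => (T - r) ^ (k + 1)) (-((k + 1 : ℕ) * (T - x) ^ k)) x := by
      intro x
      simpa using ((hasDerivAt_id' x).const_sub T).fun_pow (k + 1)
    have hu : ∀ x ∈ Set.Ioo (min 0 T) (max 0 T), HasDerivAt (G (j + 1)) (G j x) x := by
      intro x hx
      rw [min_eq_left hT, max_eq_right hT] at hx
      have hd : HasDerivAt (fun t => ∫ r in (0 : ℝ)..t, G j r) (G j x) x := by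
        refine intervalIntegral.integral_hasDerivAt_right ?_ ?_ ?_
        · refine ((hc j).mono ?_).intervalIntegrable
          rw [Set.uIcc_of_le hx.1.le]
          exact Set.Icc_subset_Icc le_rfl hx.2.le
        · exact ((hc j).mono Set.Ioo_subset_Icc_self).stronglyMeasurableAtFilter isOpen_Ioo x hx
        · exact (hc j).continuousAt (Icc_mem_nhds hx.1 hx.2)
      refine hd.congr_of_eventuallyEq ?_
      filter_upwards [Icc_mem_nhds hx.1 hx.2] with t ht using hG j t ht
    have hI : ∀ j, IntervalIntegrable (G j) MeasureTheory.volume 0 T := fun j =>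
      ContinuousOn.intervalIntegrable (by rw [Set.uIcc_of_le hT]; exact hc j)
    have := intervalIntegral.integral_deriv_mul_eq_sub_of_hasDerivAt (a := 0) (b := T)
      (u := G (j + 1)) (v := fun r => (T - r) ^ (k + 1)) (u' := G j)
      (v' := fun x => -((k + 1 : ℕ) * (T - x) ^ k)) (by rw [Set.uIcc_of_le hT]; exact hc _)
      (by fun_prop) hu (fun x _ => hv x) (hI j) (Continuous.intervalIntegrable (by fun_prop) _ _)
    rw [hGT, hG j 0 ⟨le_rfl, hT⟩, intervalIntegral.integral_same, zero_mul, zero_mul, sub_zero,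
      intervalIntegral.integral_add] at this
    · have h2 : ∫ x in (0 : ℝ)..T, G (j + 1) x * -((k + 1 : ℕ) * (T - x) ^ k) = 0 := by
        refine Eq.trans ?_ (mul_eq_zero_of_right (-((k + 1 : ℕ) : ℝ)) (ih (j + 1)))
        rw [← intervalIntegral.integral_const_mul]
        congr 1
        funext x
        ring
      rwa [h2, add_zero] at this
    · exact (hI j).mul_continuousOn (by fun_prop)
    · exact (hI (j + 1)).mul_continuousOn (by fun_prop)

/-- G 0 is orthogonal to all polynomials in T - r; by Weierstrass it is orthogonal to itself. -/
theorem eq_zero_of_iterated_integrals {T : ℝ} (hT : 0 < T) {G : ℕ → ℝ → ℝ}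
    (hc : ∀ k, ContinuousOn (G k) (Set.Icc 0 T))
    (hG : ∀ k, ∀ t ∈ Set.Icc 0 T, G (k + 1) t = ∫ r in (0 : ℝ)..t, G k r)
    (hGT : ∀ k, G k T = 0) {t : ℝ} (ht : t ∈ Set.Icc 0 T) : G 0 t = 0 := by
  have hmom := fun k => integral_mul_pow_eq_zero hT.le hc hG hGT k 0
  have hI : IntervalIntegrable (G 0) MeasureTheory.volume 0 T :=
    ContinuousOn.intervalIntegrable (by rw [Set.uIcc_of_le hT.le]; exact hc 0)
  have hpoly : ∀ q : Polynomial ℝ, ∫ r in (0 : ℝ)..T, G 0 r * q.eval (T - r) = 0 := by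
    intro q
    simp only [Polynomial.eval_eq_sum_range, Finset.mul_sum]
    rw [intervalIntegral.integral_finsetSum fun i _ => hI.mul_continuousOn (by fun_prop)]
    refine Finset.sum_eq_zero fun i _ => ?_
    refine Eq.trans ?_ (mul_eq_zero_of_right (q.coeff i) (hmom i))
    rw [← intervalIntegral.integral_const_mul]
    congr 1
    funext r
    ring
  have hIabs : IntervalIntegrable (fun r => |G 0 r|) MeasureTheory.volume 0 T := hI.abs
  have hsq : ∫ r in (0 : ℝ)..T, G 0 r * G 0 r ≤ 0 := by
    set M := ∫ r in (0 : ℝ)..T, |G 0 r| with hM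
    have hM0 : 0 ≤ M := intervalIntegral.integral_nonneg hT.le fun _ _ => abs_nonneg _
    refine le_of_forall_pos_lt_add fun ε hε => ?_
    -- The reflected function is approximated because the moments are in powers of T - r; M is the
    -- integral of |G 0|.
    obtain ⟨q, hq⟩ := exists_polynomial_near_of_continuousOn 0 T (fun x => G 0 (T - x))
      ((hc 0).comp (by fun_prop) fun x hx => ⟨by linarith [hx.2], by linarith [hx.1]⟩)
      (ε / (M + 1)) (by positivity)
    have hIGG : IntervalIntegrable (fun r => G 0 r * G 0 r) MeasureTheory.volume 0 T :=
      hI.mul_continuousOn (by rw [Set.uIcc_of_le hT.le]; exact hc 0)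
    have hIGq : IntervalIntegrable (fun r => G 0 r * q.eval (T - r)) MeasureTheory.volume 0 T :=
      hI.mul_continuousOn (by fun_prop)
    calc ∫ r in (0 : ℝ)..T, G 0 r * G 0 r
        = ∫ r in (0 : ℝ)..T, (G 0 r * G 0 r - G 0 r * q.eval (T - r)) := by
          rw [intervalIntegral.integral_sub hIGG hIGq, hpoly q, sub_zero]
      _ ≤ ∫ r in (0 : ℝ)..T, ε / (M + 1) * |G 0 r| := by
          refine intervalIntegral.integral_mono_on hT.le (hIGG.sub hIGq) (hIabs.const_mul _)
            fun r hr => ?_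
          have h1 := hq (T - r) ⟨by linarith [hr.2], by linarith [hr.1]⟩
          rw [sub_sub_cancel, abs_sub_comm] at h1
          rw [← mul_sub]
          refine (le_abs_self _).trans ?_
          rw [abs_mul, mul_comm]
          gcongr
      _ = ε / (M + 1) * M := by rw [intervalIntegral.integral_const_mul]
      _ < 0 + ε := by
          rw [div_mul_eq_mul_div, zero_add, div_lt_iff₀ (by linarith)]
          nlinarith
  by_contra hne
  have := intervalIntegral.integral_pos hT ((hc 0).mul (hc 0)) (fun x _ => mul_self_nonneg _)
    ⟨t, ht, mul_self_pos.2 hne⟩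
  exact absurd hsq (not_le.2 this)

/-! ### The signature of extended rough paths -/

section Extended

variable {p T : ℝ} {d : ℕ}

/-- The time letter. -/
abbrev ExtIndex.time {d : ℕ} : ExtIndex d := Sum.inl ()

/-- The weights of the letters: the path has finite `p`-variation, its bracket has finite
`p/2`-variation, and so does time. -/
def extWeight : ExtIndex d → ℕ := Sum.elim (fun _ => 2) (Sum.elim (fun _ => 1) (fun _ => 2))

/-- The product of letters: the bracket of two components of the path. -/
def extBracket : ExtIndex d → ExtIndex d → Option (ExtIndex d)
  | Sum.inr (Sum.inl i), Sum.inr (Sum.inl j) =>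
    some (Sum.inr (Sum.inr ⟨(min i j, max i j), min_le_max⟩))
  | _, _ => none

theorem one_le_extWeight (a : ExtIndex d) : 1 ≤ extWeight a := by
  rcases a with _ | _ | _ <;> simp [extWeight]

theorem extWeight_le_one {a : ExtIndex d} (ha : extWeight a ≤ 1) : ∃ i, a = ExtIndex.ofPath i := by
  rcases a with _ | i | _
  · simp [extWeight] at ha
  · exact ⟨i, rfl⟩
  · simp [extWeight] at ha

theorem extWeight_extBracket (a b c : ExtIndex d) (h : extBracket a b = some c) :
    extWeight c = extWeight a + extWeight b := by
  rcases a with _ | _ | _ <;> rcases b with _ | _ | _ <;> simp [extBracket] at h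
  subst h
  simp [extWeight]

variable {Y : RoughPath p T (ExtIndex d)}

theorem incr_time (hY : Y ∈ extendedRoughPaths p T d) {s t : ℝ} (h0 : 0 ≤ s) (hst : s ≤ t)
    (hT : t ≤ T) : incr Y.path s t ExtIndex.time = t - s := by
  obtain ⟨X, hX, -, -⟩ := hY
  simp [incr, hX t ⟨h0.trans hst, hT⟩, hX s ⟨h0, hst.trans hT⟩, extPath]

/-- The bracket is defined from time 0, but Chen's relation over 0 ≤ s ≤ t makes its increment the
same expression on [s,t]. This gives bracket letters order 2/p and is the base case of the
quasi-shuffle identity. -/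
theorem incr_bracket (hY : Y ∈ extendedRoughPaths p T d) {s t : ℝ} (h0 : 0 ≤ s) (hst : s ≤ t)
    (hT : t ≤ T) (i j : Fin d) (hij : i ≤ j) :
    incr Y.path s t (Sum.inr (Sum.inr ⟨(i, j), hij⟩))
      = incr Y.path s t (ExtIndex.ofPath i) * incr Y.path s t (ExtIndex.ofPath j)
        - (Y.lift s t (ExtIndex.ofPath i, ExtIndex.ofPath j)
          + Y.lift s t (ExtIndex.ofPath j, ExtIndex.ofPath i)) := by
  obtain ⟨X, hX, hL, -⟩ := hY
  rw [hL s t ⟨h0, hst, hT⟩, hL s t ⟨h0, hst, hT⟩]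
  have h1 := X.chen 0 s t le_rfl h0 hst hT i j
  have h2 := X.chen 0 s t le_rfl h0 hst hT j i
  simp only [incr, PiLp.sub_apply] at h1 h2
  simp only [incr, PiLp.sub_apply, hX t ⟨h0.trans hst, hT⟩, hX s ⟨h0, hst.trans hT⟩, extPath,
    RoughPath.bracket, Prod.swap, Sum.elim_inl, Sum.elim_inr, h1, h2]
  ring

/-- A control for extended rough paths. -/
def extControl (Y : RoughPath p T (ExtIndex d)) (s t : ℝ) : ℝ := Y.control s t + (t - s)

theorem isControl_extControl (Y : RoughPath p T (ExtIndex d)) : IsControl T (extControl Y) :=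
  Y.isControl_control.add (IsControl.length T)

/-- The 3 counts the terms of the bracket: one product of increments and two second-level
components. The other summand comes from t - s = (t - s)^(1 - 2/p) (t - s)^(2/p). -/
theorem extBound_low (hp : 2 < p) (hY : Y ∈ extendedRoughPaths p T d) (I : List (ExtIndex d))
    (hI : weight extWeight I ≤ 2) {s t : ℝ} (h0 : 0 ≤ s) (hst : s ≤ t) (hT : t ≤ T) :
    |signature Y s t I| ≤ (3 + T ^ (1 - 2 / p)) * extControl Y s t ^ (weight extWeight I / p) := by
  have hS := isLyonsExtension_signature Y
  have hp0 : 0 < p := by linarith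
  have hT0 : 0 ≤ T := h0.trans (hst.trans hT)
  have hTp : 0 ≤ T ^ (1 - 2 / p) := by positivity
  have hY0 := Y.isControl_control.nonneg s t h0 hst hT
  have hω0 := (isControl_extControl Y).nonneg s t h0 hst hT
  have hle : Y.control s t ≤ extControl Y s t := le_add_of_nonneg_right (sub_nonneg.2 hst)
  have hmono : ∀ q : ℝ, 0 ≤ q → Y.control s t ^ q ≤ extControl Y s t ^ q := fun q hq =>
    Real.rpow_le_rpow hY0 hle hq
  have hpow : ∀ q : ℝ, 0 ≤ extControl Y s t ^ q := fun q => by positivity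
  have hlen := length_le_weight one_le_extWeight I
  have h2p : 0 ≤ 2 / p := by positivity
  have hincr : ∀ i : ExtIndex d, |incr Y.path s t i| ≤ extControl Y s t ^ (1 / p) := fun i =>
    (Y.abs_incr_le h0 hst hT i).trans (hmono _ (by positivity))
  have hlift : ∀ i j : ExtIndex d, |Y.lift s t (i, j)| ≤ extControl Y s t ^ (2 / p) := fun i j =>
    (Y.abs_lift_le h0 hst hT i j).trans (hmono _ (by positivity))
  match I, hI, hlen with
  | [], _, _ => rw [hS.level_zero s t ⟨h0, hst, hT⟩]; simp; linarith
  | [a], _, _ =>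
    rw [hS.level_one s t ⟨h0, hst, hT⟩]
    rcases a with _ | i | ⟨⟨i, j⟩, hij⟩
    · rw [incr_time hY h0 hst hT, abs_of_nonneg (sub_nonneg.2 hst)]
      simp only [weight_cons, weight_nil, extWeight, Sum.elim_inl, add_zero, Nat.cast_ofNat]
      have h2p1 : 0 ≤ 1 - 2 / p := by
        rw [sub_nonneg, div_le_one hp0]; exact hp.le
      have hts : 0 ≤ t - s := sub_nonneg.2 hst
      calc t - s = (t - s) ^ (1 - 2 / p) * (t - s) ^ (2 / p) := by
            rw [← Real.rpow_add_of_nonneg hts h2p1 h2p, sub_add_cancel, Real.rpow_one]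
        _ ≤ T ^ (1 - 2 / p) * extControl Y s t ^ (2 / p) := by
            gcongr
            · linarith
            · exact le_add_of_nonneg_left hY0
        _ ≤ _ := by nlinarith [hpow (2 / p)]
    · simp only [weight_cons, weight_nil, extWeight, Sum.elim_inl, Sum.elim_inr, add_zero,
        Nat.cast_one]
      nlinarith [hincr (ExtIndex.ofPath i), hpow (1 / p)]
    · rw [incr_bracket hY h0 hst hT]
      simp only [weight_cons, weight_nil, extWeight, Sum.elim_inr, add_zero, Nat.cast_ofNat]
      have hprod : |incr Y.path s t (ExtIndex.ofPath i) * incr Y.path s t (ExtIndex.ofPath j)|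
          ≤ extControl Y s t ^ (2 / p) := by
        rw [abs_mul, show (2 : ℝ) / p = 1 / p + 1 / p by ring,
          Real.rpow_add_of_nonneg hω0 (by positivity) (by positivity)]
        exact mul_le_mul (hincr _) (hincr _) (abs_nonneg _) (hpow _)
      have h1 := hlift (ExtIndex.ofPath i) (ExtIndex.ofPath j)
      have h2 := hlift (ExtIndex.ofPath j) (ExtIndex.ofPath i)
      have h3 := hpow (2 / p)
      have h4 := mul_nonneg hTp h3
      rw [abs_le] at *
      constructor <;> linarith [hprod.1, hprod.2, h1.1, h1.2, h2.1, h2.2]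
  | [a, b], hI, _ =>
    rw [hS.level_two s t ⟨h0, hst, hT⟩]
    have ha := one_le_extWeight a
    have hb := one_le_extWeight b
    have hw : weight extWeight [a, b] = 2 := by
      simp only [weight_cons, weight_nil] at hI ⊢
      omega
    rw [hw, Nat.cast_ofNat]
    nlinarith [hlift a b, hpow (2 / p)]
  | a :: b :: c :: I, h1, h2 => simp only [List.length_cons] at h2; omega

/-- Words of length at least 3 are covered by their variation. The remaining ones are pairs with a
letter of weight 2, whose second level is a Young integral: by Chen's relation, its sum over a
partition is the integral minus the Riemann sum. -/
theorem ext_hasVanishingSums (hY : Y ∈ extendedRoughPaths p T d) (I : List (ExtIndex d))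
    (hI : 3 ≤ weight extWeight I) : HasVanishingSums T fun s t => signature Y s t I := by
  have hS := isLyonsExtension_signature Y
  rcases Nat.lt_or_ge 2 I.length with h3 | h2
  · exact hS.hasVanishingSums h3
  match I, h2 with
  | [], _ => simp at hI
  | [a], _ => rcases a with _ | _ | _ <;> simp [extWeight] at hI
  | [a, b], _ =>
    intro s t h0 hst hT ε hε
    have hab : ¬ (a ∈ Set.range ExtIndex.ofPath ∧ b ∈ Set.range ExtIndex.ofPath) := by
      rintro ⟨⟨i, rfl⟩, ⟨j, rfl⟩⟩
      simp [extWeight] at hI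
    obtain ⟨X, -, -, hYoung⟩ := hY
    obtain ⟨δ, hδ, h⟩ := hYoung s t ⟨h0, hst, hT⟩ a b hab ε hε
    obtain ⟨N, u, hu, hmesh⟩ := (IsControl.length T).exists_fine_partition h0 hst hT hδ
    refine ⟨N, u, hu, ?_⟩
    have h1 := h N u hu hmesh
    have h2 := hS.isMultiplicative.eq_sum_add_sum_mid h0 hT hu (I := [a, b]) (by simp)
    rw [hS.isMultiplicative.self_eq_zero h0 (hst.trans hT) (by simp), add_zero,
      hS.level_two s t ⟨h0, hst, hT⟩] at h2
    have h3 : ∑ i ∈ Finset.range N, mid (signature Y s (u i)) (signature Y (u i) (u (i + 1))) [a, b]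
        = ∑ i ∈ Finset.range N, incr Y.path s (u i) a * (Y.path (u (i + 1)) b - Y.path (u i) b) := by
      refine Finset.sum_congr rfl fun i hi => ?_
      rw [Finset.mem_range] at hi
      have e1 := hS.level_one s (u i) ⟨h0, hu.left_le hi.le, (hu.le_right hi.le).trans hT⟩ a
      have e2 := hS.level_one (u i) (u (i + 1)) ⟨h0.trans (hu.left_le hi.le), (hu.2.2 i hi).le,
        (hu.le_right hi).trans hT⟩ b
      simp only [mid, List.length_cons, List.length_nil, zero_add, Nat.reduceAdd,
        Nat.Ico_succ_singleton, Finset.sum_singleton, List.take_succ_cons, List.take_zero,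
        List.drop_succ_cons, List.drop_zero, e1, e2]
      simp [incr]
    rw [h3] at h2
    rw [h2, abs_sub_comm, add_sub_cancel_right] at h1
    exact h1

theorem ext_bound (hp : 2 < p) (hY : Y ∈ extendedRoughPaths p T d) (I : List (ExtIndex d)) :
    ∃ C, 0 ≤ C ∧ ∀ s t : ℝ, 0 ≤ s → s ≤ t → t ≤ T →
      |signature Y s t I| ≤ C * extControl Y s t ^ (weight extWeight I / p) := by
  rcases le_or_gt 0 T with hT0 | hT0
  swap
  · exact ⟨0, le_rfl, fun s t _ _ _ => by linarith⟩
  obtain ⟨C, hC0, hC⟩ := exists_weighted_bound (w := extWeight) Y.pos Y.lt_three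
    (show 0 ≤ 3 + T ^ (1 - 2 / p) by positivity) I
  exact ⟨C, hC0, hC T _ _ (isControl_extControl Y) (isLyonsExtension_signature Y).isMultiplicative
    (fun J hJ s t h0 hst hT => extBound_low hp hY J hJ h0 hst hT) (ext_hasVanishingSums hY)⟩

/-- The coordinates of the signature of an extended rough path multiply by quasi-shuffles. -/
theorem signature_mul (hp : 2 < p) (hY : Y ∈ extendedRoughPaths p T d) (I J : List (ExtIndex d))
    {s t : ℝ} (h0 : 0 ≤ s) (hst : s ≤ t) (hT : t ≤ T) :
    signature Y s t I * signature Y s t J = qeval extBracket (signature Y s t) I J := by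
  have hS := isLyonsExtension_signature Y
  refine hS.isMultiplicative.mul_eq_qeval (isControl_extControl Y) Y.pos Y.lt_three
    (ext_bound hp hY) extWeight_extBracket (fun I J hI hJ hIJ s t h0 hst hT => ?_) I J h0 hst hT
  obtain ⟨a, I, rfl⟩ := List.exists_cons_of_ne_nil hI
  obtain ⟨b, J, rfl⟩ := List.exists_cons_of_ne_nil hJ
  simp only [weight_cons] at hIJ
  have h1 := one_le_extWeight a
  have h2 := one_le_extWeight b
  have h3 := length_le_weight one_le_extWeight I
  have h4 := length_le_weight one_le_extWeight J
  -- Two non-empty words of total weight at most 2 are single path letters, for which the identity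
  -- is the definition of the bracket.
  obtain ⟨i, rfl⟩ := extWeight_le_one (a := a) (by omega)
  obtain ⟨j, rfl⟩ := extWeight_le_one (a := b) (by omega)
  obtain rfl := List.length_eq_zero_iff.1 (show I.length = 0 by omega)
  obtain rfl := List.length_eq_zero_iff.1 (show J.length = 0 by omega)
  rw [qeval_cons_cons]
  simp only [qeval_nil_left, qeval_nil_right, shift_apply, extBracket, Option.elim_some,
    hS.level_one s t ⟨h0, hst, hT⟩, hS.level_two s t ⟨h0, hst, hT⟩]
  rw [incr_bracket hY h0 hst hT]
  rcases le_total i j with h | h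
  · rw [min_eq_left h, max_eq_right h]; ring
  · rw [min_eq_right h, max_eq_left h]; ring

theorem continuousOn_signature (Y : RoughPath p T (ExtIndex d)) (I : List (ExtIndex d)) :
    ContinuousOn (fun t => signature Y 0 t I) (Set.Icc 0 T) := by
  have h := (PiLp.continuous_apply 2 (fun _ : Fin I.length → ExtIndex d => ℝ) I.get).comp_continuousOn
    ((isLyonsExtension_signature Y).continuousOn I.length)
  simp only [Function.comp_def, level_get] at h
  exact h.comp (f := fun t : ℝ => ((0 : ℝ), t)) (by fun_prop) fun t ht => ⟨le_rfl, ht.1, ht.2⟩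

theorem signature_append_time (hp : 2 < p) (hY : Y ∈ extendedRoughPaths p T d)
    (I : List (ExtIndex d)) {t : ℝ} (h0 : 0 ≤ t) (hT : t ≤ T) :
    signature Y 0 t (I ++ [ExtIndex.time]) = ∫ r in (0 : ℝ)..t, signature Y 0 r I := by
  have hS := isLyonsExtension_signature Y
  refine hS.isMultiplicative.eq_integral (isControl_extControl Y) Y.pos Y.lt_three
    (ext_bound hp hY) one_le_extWeight rfl (fun s t h0 hst hT => ?_) (continuousOn_signature Y I)
    h0 hT
  rw [hS.level_one s t ⟨h0, hst, hT⟩, incr_time hY h0 hst hT]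

/-- The signature at time `T` determines the signature on `[0,T]`. -/
theorem signature_eq_of_terminal_eq (hp : 2 < p) (hT : 0 < T) {Y Y' : RoughPath p T (ExtIndex d)}
    (hY : Y ∈ extendedRoughPaths p T d) (hY' : Y' ∈ extendedRoughPaths p T d)
    (h : ∀ I, signature Y 0 T I = signature Y' 0 T I) (I : List (ExtIndex d)) {t : ℝ}
    (h0 : 0 ≤ t) (ht : t ≤ T) : signature Y 0 t I = signature Y' 0 t I := by
  have hint : ∀ (Y : RoughPath p T (ExtIndex d)) (I : List (ExtIndex d)), ∀ t ∈ Set.Icc 0 T,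
      IntervalIntegrable (fun r => signature Y 0 r I) MeasureTheory.volume 0 t := fun Y I t ht => by
    refine ((continuousOn_signature Y I).mono ?_).intervalIntegrable
    rw [Set.uIcc_of_le ht.1]
    exact Set.Icc_subset_Icc le_rfl ht.2
  -- Appending k time letters to I gives the k-fold iterated integral of the difference of
  -- coordinates, zero at T by assumption.
  have := eq_zero_of_iterated_integrals hT
    (G := fun k t => signature Y 0 t (I ++ List.replicate k ExtIndex.time)
      - signature Y' 0 t (I ++ List.replicate k ExtIndex.time))
    (fun k => (continuousOn_signature Y _).sub (continuousOn_signature Y' _))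
    (fun k t ht => ?_) (fun k => sub_eq_zero.2 (h _)) ⟨h0, ht⟩
  · simpa [sub_eq_zero] using this
  · rw [intervalIntegral.integral_sub (hint Y _ t ht) (hint Y' _ t ht),
      ← signature_append_time hp hY _ ht.1 ht.2, ← signature_append_time hp hY' _ ht.1 ht.2,
      List.replicate_succ', List.append_assoc]

theorem rVar_eq_zero {E : Type*} [NormedAddCommGroup E] {r : ℝ} (hr : 0 < r) {A : ℝ → ℝ → E}
    {s t : ℝ} (h : ∀ u v : ℝ, s ≤ u → u ≤ v → v ≤ t → A u v = 0) : rVar r A s t = 0 := by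
  rw [rVar, one_div, ENNReal.rpow_eq_zero_iff_of_pos (inv_pos.2 hr)]
  simp only [ENNReal.iSup_eq_zero]
  intro N u hu
  refine Finset.sum_eq_zero fun i hi => ?_
  rw [Finset.mem_range] at hi
  rw [h _ _ (hu.left_le hi.le) (hu.2.2 i hi).le (hu.le_right hi), enorm_zero,
    ENNReal.zero_rpow_of_pos hr]

/-- The signature at time `T` separates extended rough paths. -/
theorem edist_eq_zero_of_signature_eq (hp : 2 < p) (hT : 0 < T)
    {Y Y' : RoughPath p T (ExtIndex d)} (hY : Y ∈ extendedRoughPaths p T d)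
    (hY' : Y' ∈ extendedRoughPaths p T d)
    (h : ∀ I, signature Y 0 T I = signature Y' 0 T I) : edist Y Y' = 0 := by
  have hS := isLyonsExtension_signature Y
  have hS' := isLyonsExtension_signature Y'
  have key : ∀ (I : List (ExtIndex d)) (t : ℝ), 0 ≤ t → t ≤ T → _ := fun I t h0 ht =>
    signature_eq_of_terminal_eq hp hT hY hY' h I h0 ht
  have h1 : ∀ t, 0 ≤ t → t ≤ T → incr Y.path 0 t = incr Y'.path 0 t := by
    intro t h0 ht
    ext a
    rw [← hS.level_one 0 t ⟨le_rfl, h0, ht⟩, ← hS'.level_one 0 t ⟨le_rfl, h0, ht⟩, key _ _ h0 ht]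
  have h2 : ∀ t, 0 ≤ t → t ≤ T → ∀ a b, Y.lift 0 t (a, b) = Y'.lift 0 t (a, b) := by
    intro t h0 ht a b
    rw [← hS.level_two 0 t ⟨le_rfl, h0, ht⟩, ← hS'.level_two 0 t ⟨le_rfl, h0, ht⟩, key _ _ h0 ht]
  have h3 : ∀ s t, 0 ≤ s → s ≤ t → t ≤ T → incr Y.path s t = incr Y'.path s t := by
    intro s t h0 hst ht
    have e1 := h1 s h0 (hst.trans ht)
    have e2 := h1 t (h0.trans hst) ht
    simp only [incr] at e1 e2 ⊢
    rw [← sub_sub_sub_cancel_right (Y.path t) (Y.path s) (Y.path 0), e1, e2,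
      sub_sub_sub_cancel_right]
  -- Chen's relation over 0 ≤ s ≤ t determines the second level on [s,t] from data started at 0.
  have h4 : ∀ s t, 0 ≤ s → s ≤ t → t ≤ T → Y.lift s t = Y'.lift s t := by
    intro s t h0 hst ht
    ext ⟨a, b⟩
    have e1 := Y.chen 0 s t le_rfl h0 hst ht a b
    have e2 := Y'.chen 0 s t le_rfl h0 hst ht a b
    rw [h2 t (h0.trans hst) ht, h2 s h0 (hst.trans ht), h3 0 s le_rfl h0 (hst.trans ht),
      h3 s t h0 hst ht] at e1
    linarith
  have z1 : rVar p (fun s t => incr Y.path s t - incr Y'.path s t) 0 T = 0 :=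
    rVar_eq_zero Y.pos fun u v h0 huv hv => sub_eq_zero.2 (h3 u v h0 huv hv)
  have z2 : rVar (p / 2) (fun s t => Y.lift s t - Y'.lift s t) 0 T = 0 :=
    rVar_eq_zero (half_pos Y.pos) fun u v h0 huv hv => sub_eq_zero.2 (h4 u v h0 huv hv)
  change rVar p (fun s t => incr Y.path s t - incr Y'.path s t) 0 T
    + rVar (p / 2) (fun s t => Y.lift s t - Y'.lift s t) 0 T = 0
  rw [z1, z2, add_zero]

/-! ### Density of the linear functionals of the signature -/

/-- A coordinate of the signature at time `T`, as a continuous function on a set of rough paths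
modulo inseparability. -/
def signatureCoord (hp0 : 0 < p) (hp : p < 3) (hT : 0 ≤ T) (K : Set (RoughPath p T (ExtIndex d)))
    (I : List (ExtIndex d)) : C(SeparationQuotient K, ℝ) where
  toFun := SeparationQuotient.lift (fun X : K => signature X.1 0 T I) fun _ _ h =>
    (h.map ((continuous_signature hp0 hp I le_rfl hT le_rfl).comp continuous_subtype_val)).eq
  continuous_toFun := SeparationQuotient.continuous_lift
    ((continuous_signature hp0 hp I le_rfl hT le_rfl).comp continuous_subtype_val)

@[simp] theorem signatureCoord_mk (hp0 : 0 < p) (hp : p < 3) (hT : 0 ≤ T)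
    (K : Set (RoughPath p T (ExtIndex d))) (I : List (ExtIndex d)) (X : K) :
    signatureCoord hp0 hp hT K I (SeparationQuotient.mk X) = signature X.1 0 T I := rfl

open scoped Pointwise in
-- It suffices to multiply generators, and a product of two coordinates is a sum of coordinates over
-- their quasi-shuffles.
theorem signatureCoord_mul_mem (hp : 2 < p) (hp0 : 0 < p) (hp' : p < 3) (hT : 0 ≤ T)
    {K : Set (RoughPath p T (ExtIndex d))} (hK : K ⊆ extendedRoughPaths p T d)
    (g g' : C(SeparationQuotient K, ℝ))
    (hg : g ∈ Submodule.span ℝ (Set.range (signatureCoord hp0 hp' hT K)))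
    (hg' : g' ∈ Submodule.span ℝ (Set.range (signatureCoord hp0 hp' hT K))) :
    g * g' ∈ Submodule.span ℝ (Set.range (signatureCoord hp0 hp' hT K)) := by
  have h := Submodule.mul_mem_mul hg hg'
  rw [Submodule.span_mul_span] at h
  refine (Submodule.span_le.2 ?_) h
  rintro _ ⟨_, ⟨I, rfl⟩, _, ⟨J, rfl⟩, rfl⟩
  have : signatureCoord hp0 hp' hT K I * signatureCoord hp0 hp' hT K J
      = ((quasiShuffle extBracket I J).map (signatureCoord hp0 hp' hT K)).sum := by
    ext x
    obtain ⟨X, rfl⟩ := SeparationQuotient.surjective_mk x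
    rw [ContinuousMap.mul_apply, signatureCoord_mk, signatureCoord_mk,
      signature_mul hp (hK X.2) I J le_rfl hT le_rfl, qeval]
    induction quasiShuffle extBracket I J with
    | nil => simp
    | cons L l ih => simp [ih]
  beta_reduce
  rw [this]
  refine list_sum_mem fun y hy => ?_
  obtain ⟨L, -, rfl⟩ := List.mem_map.1 hy
  exact Submodule.subset_span ⟨L, rfl⟩

/-- On compact sets of extended rough paths, continuous functions are uniformly approximated by
linear functionals of the signature. -/
theorem exists_pairing_near (hp : 2 < p) (hp' : p < 3) (hT : 0 < T)
    {K : Set (RoughPath p T (ExtIndex d))} (hK : K ⊆ extendedRoughPaths p T d)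
    (hKc : IsCompact K) {f : RoughPath p T (ExtIndex d) → ℝ} (hf : ContinuousOn f K)
    {ε : ℝ} (hε : 0 < ε) :
    ∃ ℓ : List (ExtIndex d) →₀ ℝ, ∀ X ∈ K, |f X - pairing ℓ (signature X 0 T)| < ε := by
  have hp0 : 0 < p := by linarith
  have : CompactSpace K := isCompact_iff_compactSpace.1 hKc
  have : CompactSpace (SeparationQuotient K) :=
    SeparationQuotient.surjective_mk.compactSpace SeparationQuotient.continuous_mk
  have hfc : Continuous fun X : K => f X.1 := continuousOn_iff_continuous_domRestrict.1 hf
  let φ := signatureCoord hp0 hp' hT.le K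
  -- Only paths at positive distance can be separated, so Stone–Weierstrass is applied on the
  -- quotient by inseparability, through which every continuous function on K factors.
  let F : C(SeparationQuotient K, ℝ) :=
    ⟨SeparationQuotient.lift (fun X : K => f X.1) fun _ _ h => (h.map hfc).eq,
      SeparationQuotient.continuous_lift hfc⟩
  -- The unit is the coordinate on the empty word.
  let A : Subalgebra ℝ C(SeparationQuotient K, ℝ) :=
    (Submodule.span ℝ (Set.range φ)).toSubalgebra
      (Submodule.subset_span ⟨[], by
        ext x
        obtain ⟨X, rfl⟩ := SeparationQuotient.surjective_mk x
        exact (isLyonsExtension_signature X.1).level_zero 0 T ⟨le_rfl, hT.le, le_rfl⟩⟩)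
      (signatureCoord_mul_mem hp hp0 hp' hT.le hK)
  have hsep : A.SeparatesPoints := by
    intro x y hxy
    obtain ⟨X, rfl⟩ := SeparationQuotient.surjective_mk x
    obtain ⟨Y, rfl⟩ := SeparationQuotient.surjective_mk y
    by_contra! hcon
    refine hxy (SeparationQuotient.mk_eq_mk.2 (EMetric.inseparable_iff.2 ?_))
    refine edist_eq_zero_of_signature_eq hp hT (hK X.2) (hK Y.2) fun I => ?_
    exact hcon (φ I) ⟨φ I, Submodule.subset_span ⟨I, rfl⟩, rfl⟩
  obtain ⟨⟨g, hg⟩, hgF⟩ :=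
    ContinuousMap.exists_mem_subalgebra_near_continuousMap_of_separatesPoints A hsep F ε hε
  obtain ⟨ℓ, hℓ⟩ := Finsupp.mem_span_range_iff_exists_finsupp.1
    (show g ∈ Submodule.span ℝ (Set.range φ) from hg)
  refine ⟨ℓ, fun X hX => ?_⟩
  have h1 := (ContinuousMap.norm_lt_iff _ hε).1 hgF (SeparationQuotient.mk ⟨X, hX⟩)
  have h2 : g (SeparationQuotient.mk ⟨X, hX⟩) = pairing ℓ (signature X 0 T) := by
    rw [← hℓ, pairing, Finsupp.sum, Finsupp.sum, ContinuousMap.sum_apply]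
    rfl
  rw [ContinuousMap.sub_apply, h2, Real.norm_eq_abs, abs_sub_comm] at h1
  exact h1

end Extended

end RoughUAT

end

/-! ### The approximation theorem. -/

open RoughUAT in
theorem mainTheorem1 (p T : ℝ) (hp : 2 < p) (hp' : p < 3) (hT : 0 < T) (d : ℕ)
    (K : Set (RoughPath p T (ExtIndex d))) (hK : K ⊆ extendedRoughPaths p T d)
    (hKc : IsCompact K) (f : RoughPath p T (ExtIndex d) → ℝ) (hf : ContinuousOn f K)
    (L : ℝ) (hL : 0 < L) :
    -- Lyons' extension exists and is unique, so that `signature` below is meaningful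
    (∀ X ∈ K, IsLyonsExtension X (signature X) ∧
      ∀ S, IsLyonsExtension X S → ∀ s t : ℝ, (s, t) ∈ simplex T → S s t = signature X s t) ∧
    ∀ ε : ℝ, 0 < ε → ∃ ℓ : List (ExtIndex d) →₀ ℝ,
      (⨆ X ∈ boundedPart K L, ENNReal.ofReal |f X - pairing ℓ (signature X 0 T)|)
        < ENNReal.ofReal ε := by
  refine ⟨fun X _ => ⟨isLyonsExtension_signature X, fun S hS s t hst => ?_⟩, fun ε hε => ?_⟩
  · funext I
    exact hS.unique (isLyonsExtension_signature X) I hst.1 hst.2.1 hst.2.2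
  · obtain ⟨ℓ, hℓ⟩ := exists_pairing_near hp hp' hT hK hKc hf (half_pos hε)
    refine ⟨ℓ, lt_of_le_of_lt (iSup₂_le fun X hX => ENNReal.ofReal_le_ofReal (hℓ X hX.1).le) ?_⟩
    exact (ENNReal.ofReal_lt_ofReal_iff hε).2 (half_lt_self hε)
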